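/- **Setting.** For each $N$ let $U=\{1,\dots,N\}$ be a finite population with real $y_i$ and $x_i\in\mathbb R^p$ $(i\in U)$ (all of these may depend on $N$), and let $A\subseteq U$ be a random sample drawn from a sampling design, of size $n=|A|$ (in [B1], [B2] a random $n$ is replaced by $\mathrm E(n)$), with indicators $\delta_i=1\{i\in A\}$, inclusion probabilities $\pi_i=P(i\in A)$, $\pi_{ij}=P(i,j\in A)$, $\Delta_{ij}=\pi_{ij}-\pi_i\pi_j$, and weights $d_i=\pi_i^{-1}$. Let $G:\mathcal V\to\mathbb R$ have derivative $g=G'$, let $f=g^{-1}:g(\mathcal V)\to\mathcal V$ (the derivative of the convex conjugate of $G$), and put $z_i^\top=(x_i^\top,g(d_i))$, $\theta_N=\sum_{i\in U}y_i$. Let $\hat\omega=(\hat\omega_i)_{i\in A}$ minimize $\sum_{i\in A}G(\omega_i)$ over all $\omega\in\mathcal V^A$ with $\sum_{i\in A}\omega_iz_i=\sum_{i\in U}z_i$, with $\hat\omega$ arbitrary for samples $A$ for which there is no minimizer, and put $\hat\theta_{\rm cal}=\sum_{i\in A}\hat\omega_iy_i$. Let $$\gamma_N=\Big\{\sum_{i\in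 U}\frac{\pi_iz_iz_i^\top}{g'(d_i)}\Big\}^{-1}\sum_{i\in U}\frac{\pi_iz_iy_i}{g'(d_i)},\qquad \hat\theta_{{\rm greg},\ell}=\sum_{i\in U}z_i^\top\gamma_N+\sum_{i\in A}\frac1{\pi_i}(y_i-z_i^\top\gamma_N).$$ **Assumptions.** [A1] $\mathcal V$ is an interval, $G$ is strictly convex and twice continuously differentiable on $\mathcal V$, and $g'>0$ on $\mathcal V$. [A2] There are positive $c_1,c_2\in\mathcal V$ with $c_1<\pi_i^{-1}<c_2$ for all $N$ and $i\in U$. [A3] $\limsup_{N}N\max_{i\ne j}|\Delta_{ij}|<\infty$. [A4] $\lim_N N^{-1}\sum_{i\in U}z_iz_i^\top$ exists and is positive definite; $\limsup_N N^{-1}\sum_{i\in U}\|(y_i,x_i^\top)\|^4<\infty$; and for all $\lambda$ in a neighbourhood of $\lambda_0=(0,\dots,0,1)^\top$ the limit $\Gamma(\lambda)=\lim_N N^{-1}\sum_{i\in U}f'(\lambda^\top z_i)z_iz_i^\top$ exists (in particular $\lambda^\top z_i\in g(\mathcal V)$ for all $i\in U$ when $N$ is large). [B1] With $u_i^\top=(y_i,z_i^\top)$,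 the limit of $\frac n{N^2}\sum_{i,j\in U}\frac{\Delta_{ij}}{\pi_i\pi_j}u_iu_j^\top$ exists and is positive definite. [B2] The Horvitz–Thompson estimator of the total of $u_i$ is asymptotically normal under the design, in the following sense: with $W_N=\mathbb V\{\sum_{i\in U}(1-\delta_i/\pi_i)u_i\}=\sum_{i,j\in U}\frac{\Delta_{ij}}{\pi_i\pi_j}u_iu_j^\top$, if $\limsup_N N^{-1}\sum_{i\in U}\|u_i\|^4<\infty$ and $\frac{n}{N^2}W_N$ has a positive definite limit, then $W_N^{-1/2}\sum_{i\in U}(1-\delta_i/\pi_i)u_i\stackrel d\to N(0,I)$. **Theorem 2 (Asymptotic normality).** Under [A1]–[A4], [B1] and [B2], $\hat\omega$ exists and is unique with probability tending to one, and $$\frac{\hat\theta_{\rm cal}-\theta_N}{\sqrt{\mathbb V(\hat\theta_{\rm cal})}}\stackrel d\to N(0,1),$$ where $\mathbb V(\hat\theta_{\rm cal})$ denotes the asymptotic variance and satisfies $\mathbb V(\hat\theta_{\rm cal})=\mathbb V(\hat\theta_{{\rm greg},\ell})\{1+o(1)\}$. Precisely: for a real sequence $v_N$, $(\hat\theta_{\rm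 cal}-\theta_N)/\sqrt{v_N}\stackrel d\to N(0,1)$ holds if and only if $v_N=\mathbb V(\hat\theta_{{\rm greg},\ell})\{1+o(1)\}$. Moreover, for every $N$, the design variance of $\hat\theta_{{\rm greg},\ell}$ is $$\mathbb V(\hat\theta_{{\rm greg},\ell})=\sum_{i,j\in U}(\pi_{ij}-\pi_i\pi_j)\frac{y_i-z_i^\top\gamma_N}{\pi_i}\,\frac{y_j-z_j^\top\gamma_N}{\pi_j}.$$ -/

import Mathlib

open MeasureTheory ProbabilityTheory Filter Topology Matrix Asymptotics

noncomputable section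

/-- A probability sampling design on the population `U = {1, …, N}` (encoded as `Fin N`): a
probability distribution on the subsets of `U`; the random subset is the sample `A`. -/
abbrev SamplingDesign (N : ℕ) : Type := PMF (Finset (Fin N))

namespace SamplingDesign

variable {N : ℕ} (D : SamplingDesign N)

/-- The law of the sample. -/
def law : Measure (Finset (Fin N)) := D.toMeasure

instance : IsProbabilityMeasure D.law :=
  inferInstanceAs (IsProbabilityMeasure D.toMeasure)

/-- First-order inclusion probability `π_i = P(i ∈ A)`. -/
def incl (i : Fin N) : ℝ := D.law.real {A | i ∈ A}

/-- Joint inclusion probability `π_ij = P(i ∈ A, j ∈ A)` (so `π_ii = π_i`). -/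
def incl₂ (i j : Fin N) : ℝ := D.law.real {A | i ∈ A ∧ j ∈ A}

/-- `Δ_ij = π_ij - π_i π_j`. -/
def Δ (i j : Fin N) : ℝ := D.incl₂ i j - D.incl i * D.incl j

/-- The design weight `d_i = 1 / π_i`. -/
def weight (i : Fin N) : ℝ := (D.incl i)⁻¹

/-- The (expected) sample size `E(n)`, where `n = |A|`. -/
def size : ℝ := ∫ A, (A.card : ℝ) ∂D.law

/-- The sampling indicator `δ_i`, as a function of the sample. -/
def δ (i : Fin N) (A : Finset (Fin N)) : ℝ := if i ∈ A then 1 else 0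

/-- The centred Horvitz–Thompson sum `∑_{i ∈ U} (1 - δ_i / π_i) w_i` of vectors `w_i`. -/
def htError {ι : Type*} (w : Fin N → ι → ℝ) (A : Finset (Fin N)) : ι → ℝ :=
  ∑ i, (1 - δ i A / D.incl i) • w i

/-- The design covariance matrix of the Horvitz–Thompson sum,
`∑_{i,j ∈ U} (π_ij - π_i π_j) / (π_i π_j) w_i w_jᵀ`. -/
def htCov {ι : Type*} (w : Fin N → ι → ℝ) : Matrix ι ι ℝ :=
  ∑ i, ∑ j, (D.Δ i j / (D.incl i * D.incl j)) • vecMulVec (w i) (w j)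

end SamplingDesign

/-- The matrix `M^{-1/2}` of a symmetric positive definite real matrix `M`
(continuous functional calculus). -/
def Matrix.invSqrt {ι : Type*} [Fintype ι] [DecidableEq ι] (M : Matrix ι ι ℝ) : Matrix ι ι ℝ :=
  cfc (fun t : ℝ => (√t)⁻¹) M

/-- `limsup_N N⁻¹ ∑_{i ∈ U_N} ‖w_i‖⁴ < ∞`, with the Euclidean norm. -/
def BoundedFourthMoment {ι : Type*} [Fintype ι] (w : (N : ℕ) → Fin N → ι → ℝ) : Prop :=
  ∃ C : ℝ, ∀ᶠ N : ℕ in atTop, (N : ℝ)⁻¹ * ∑ i, (∑ j, (w N i j) ^ 2) ^ 2 ≤ C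

/-- Asymptotic normality of the Horvitz–Thompson estimator of the totals of the vectors `w_i` under
a sequence of designs: if the vectors have bounded average fourth moments and
`(n / N²) V{∑ (1 - δ_i / π_i) w_i}` is positive definite in the limit, then the standardized sum
`[V{∑ (1 - δ_i / π_i) w_i}]^{-1/2} ∑ (1 - δ_i / π_i) w_i` converges in distribution
to `N(0, I)`. -/
def HTAsymptoticallyNormal {ι : Type*} [Fintype ι] [DecidableEq ι]
    (D : (N : ℕ) → SamplingDesign N) (w : (N : ℕ) → Fin N → ι → ℝ) : Prop :=
  BoundedFourthMoment w →
  (∃ S : Matrix ι ι ℝ, S.PosDef ∧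
    Tendsto (fun N : ℕ => ((D N).size / (N : ℝ) ^ 2) • (D N).htCov (w N)) atTop (𝓝 S)) →
  TendstoInDistribution
    (fun N (A : Finset (Fin N)) => ((D N).htCov (w N)).invSqrt *ᵥ (D N).htError (w N) A)
    atTop (id : (ι → ℝ) → ι → ℝ) (fun N => (D N).law) (Measure.pi fun _ : ι => gaussianReal 0 1)

/-- The data of entropy calibration along a sequence of finite populations `U_N = {1, …, N}`:
an entropy `G` with domain `V`, the study variable `y_i`, the `p`-dimensional auxiliary variables
`x_i`, and a sampling design for each `N`. -/
structure EntropyCalibration (p : ℕ) where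
  /-- the domain of the entropy -/
  V : Set ℝ
  /-- the generalized entropy function -/
  G : ℝ → ℝ
  /-- the study variable -/
  y : (N : ℕ) → Fin N → ℝ
  /-- the auxiliary variables -/
  x : (N : ℕ) → Fin N → Fin p → ℝ
  /-- the sampling designs -/
  design : (N : ℕ) → SamplingDesign N

namespace EntropyCalibration

variable {p : ℕ} (S : EntropyCalibration p)

/-- `g = G'` on `V`. -/
def g : ℝ → ℝ := derivWithin S.G S.V

/-- `g' = G''` on `V`. -/
def g' : ℝ → ℝ := derivWithin S.g S.V

/-- The inverse function `g⁻¹ : g(V) → V`. -/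
def gInv : ℝ → ℝ := Function.invFunOn S.g S.V

/-- The convex conjugate `F(t) = - G(g⁻¹(t)) + g⁻¹(t) t` on `g(V)`. -/
def F (t : ℝ) : ℝ := - S.G (S.gInv t) + S.gInv t * t

/-- `f = F'` on `g(V)`. -/
def f : ℝ → ℝ := derivWithin S.F (S.g '' S.V)

/-- `f'` on `g(V)`. -/
def f' : ℝ → ℝ := derivWithin S.f (S.g '' S.V)

/-- The inclusion probabilities `π_i`. -/
def π (N : ℕ) (i : Fin N) : ℝ := (S.design N).incl i

/-- The design weights `d_i = 1 / π_i`. -/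
def d (N : ℕ) (i : Fin N) : ℝ := (S.design N).weight i

/-- The covariates `z_iᵀ = (x_iᵀ, g(d_i)) ∈ ℝ^{p+1}`; the last coordinate is indexed
by `Unit`. -/
def z (N : ℕ) (i : Fin N) : Fin p ⊕ Unit → ℝ := Sum.elim (S.x N i) fun _ => S.g (S.d N i)

/-- The vectors `(y_i, x_iᵀ)`. -/
def yx (N : ℕ) (i : Fin N) : Unit ⊕ Fin p → ℝ := Sum.elim (fun _ => S.y N i) (S.x N i)

/-- The vectors `(y_i, z_iᵀ)`. -/
def yz (N : ℕ) (i : Fin N) : Unit ⊕ (Fin p ⊕ Unit) → ℝ := Sum.elim (fun _ => S.y N i) (S.z N i)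

/-- The population total `θ_N = ∑_{i ∈ U} y_i`. -/
def θ (N : ℕ) : ℝ := ∑ i, S.y N i

/-- Weights `ω ∈ Ω_A ∩ V^n`: they lie in the domain of the entropy and satisfy the calibration
constraints `∑_{i ∈ A} ω_i z_i = ∑_{i ∈ U} z_i`. -/
def feasible (N : ℕ) (A : Finset (Fin N)) : Set (A → ℝ) :=
  {ω | (∀ i, ω i ∈ S.V) ∧ ∑ i : A, ω i • S.z N i = ∑ i, S.z N i}

/-- `ω` solves the calibration problem for the sample `A`: it minimizes `∑_{i ∈ A} G(ω_i)` over
`Ω_A ∩ V^n`. -/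
def IsCalibrated (N : ℕ) (A : Finset (Fin N)) (ω : A → ℝ) : Prop :=
  ω ∈ S.feasible N A ∧ IsMinOn (fun ω : A → ℝ => ∑ i, S.G (ω i)) (S.feasible N A) ω

/-- The linear estimator `∑_{i ∈ A} ω_i y_i`. -/
def estimator (N : ℕ) (A : Finset (Fin N)) (ω : A → ℝ) : ℝ := ∑ i : A, ω i * S.y N i

/-- `γ_N = {∑_{i ∈ U} π_i z_i z_iᵀ / g'(d_i)}⁻¹ ∑_{i ∈ U} π_i z_i y_i / g'(d_i)`. -/
def γ (N : ℕ) : Fin p ⊕ Unit → ℝ :=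
  (∑ i, (S.π N i / S.g' (S.d N i)) • vecMulVec (S.z N i) (S.z N i))⁻¹ *ᵥ
    ∑ i, (S.π N i * S.y N i / S.g' (S.d N i)) • S.z N i

/-- The residual `y_i - z_iᵀ γ_N`. -/
def residual (N : ℕ) (i : Fin N) : ℝ := S.y N i - S.z N i ⬝ᵥ S.γ N

/-- `θ̂_{greg,ℓ} = ∑_{i ∈ U} z_iᵀ γ_N + ∑_{i ∈ A} (y_i - z_iᵀ γ_N) / π_i`. -/
def greg (N : ℕ) (A : Finset (Fin N)) : ℝ :=
  ∑ i, S.z N i ⬝ᵥ S.γ N + ∑ i ∈ A, (S.π N i)⁻¹ * S.residual N i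

/-- `∑_{i,j ∈ U} (π_ij - π_i π_j) (y_i - z_iᵀ γ_N) / π_i (y_j - z_jᵀ γ_N) / π_j`. -/
def gregVar (N : ℕ) : ℝ :=
  ∑ i, ∑ j, (S.design N).Δ i j * (S.residual N i / S.π N i) * (S.residual N j / S.π N j)

/-- `λ_0 = (0, …, 0, 1)`. -/
def lam₀ : Fin p ⊕ Unit → ℝ := Sum.elim (fun _ => 0) fun _ => 1

/-- `G` is strictly convex and twice continuously differentiable on the interval `V`, with
`g' = G'' > 0`, so that `g⁻¹` is differentiable. -/
structure RegularEntropy : Prop where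
  interval : S.V.OrdConnected
  strictConvex : StrictConvexOn ℝ S.V S.G
  contDiff : ContDiffOn ℝ 2 S.G S.V
  deriv_pos : ∀ v ∈ S.V, 0 < S.g' v

/-- The design weights are bounded by two positive points of the domain `V`. -/
def BoundedWeights : Prop :=
  ∃ c₁ ∈ S.V, ∃ c₂ ∈ S.V, 0 < c₁ ∧ 0 < c₂ ∧ ∀ N i, c₁ < S.d N i ∧ S.d N i < c₂

/-- `limsup_N N max_{i ≠ j} |Δ_ij| < ∞`. -/
def WeakDependence : Prop :=
  ∃ C : ℝ, ∀ᶠ N : ℕ in atTop, ∀ i j : Fin N, i ≠ j → (N : ℝ) * |(S.design N).Δ i j| ≤ C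

/-- Moment conditions. In `gamma_exists`, the limit `Γ(λ)` exists for all `λ` near `λ_0`; its terms
`f'(λᵀ z_i)` make sense when `λᵀ z_i` lies in the domain `g(V)` of `f`. -/
structure MomentConditions : Prop where
  sigma_z : ∃ M : Matrix (Fin p ⊕ Unit) (Fin p ⊕ Unit) ℝ, M.PosDef ∧
    Tendsto (fun N : ℕ => (N : ℝ)⁻¹ • ∑ i, vecMulVec (S.z N i) (S.z N i)) atTop (𝓝 M)
  fourth_moment : BoundedFourthMoment S.yx
  gamma_exists : ∀ᶠ l in 𝓝 (lam₀ : Fin p ⊕ Unit → ℝ),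
    (∀ᶠ N : ℕ in atTop, ∀ i : Fin N, l ⬝ᵥ S.z N i ∈ S.g '' S.V) ∧
    ∃ M : Matrix (Fin p ⊕ Unit) (Fin p ⊕ Unit) ℝ,
      Tendsto (fun N : ℕ => (N : ℝ)⁻¹ • ∑ i, S.f' (l ⬝ᵥ S.z N i) • vecMulVec (S.z N i) (S.z N i))
        atTop (𝓝 M)

/-- The normalized design covariance matrix of the Horvitz–Thompson estimator of the totals of
`(y_i, z_iᵀ)` has a positive definite limit. -/
def HTCovariancePosDef : Prop :=
  ∃ M : Matrix (Unit ⊕ (Fin p ⊕ Unit)) (Unit ⊕ (Fin p ⊕ Unit)) ℝ, M.PosDef ∧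
    Tendsto (fun N : ℕ => ((S.design N).size / (N : ℝ) ^ 2) • (S.design N).htCov (S.yz N))
      atTop (𝓝 M)

/-- Asymptotic normality of the Horvitz–Thompson estimator of the totals of `(y_i, z_iᵀ)`. -/
def HTNormality : Prop := HTAsymptoticallyNormal S.design S.yz

end EntropyCalibration

end

/-! By convex duality the calibrated weights have the form `gInv (λ ⬝ᵥ z_i)`. Any multiplier `λ` for
which these weights satisfy the constraints gives a minimizer, by the tangent inequality for `G`
(`isCalibrated_of_multiplier`), and strict convexity gives uniqueness. At `λ₀` the weights are the
design weights `d_i`, so the defect in the constraints is a Horvitz–Thompson error. By weak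
dependence and Chebyshev's inequality it is `O_p(√N)`. The gradient of the dual objective is
strongly monotone near `λ₀` with constant of order `N`, because the sample second moment matrix of
`z` is uniformly positive with probability tending to one. A zero therefore exists at distance
`O_p(N^(-1/2))` from `λ₀` (`exists_multiplier`). The expansion of `gInv` must hold simultaneously
for all `i`. Fourth moments give `max ‖z_i‖ = O(N^(1/4))`, so a ball of radius `N^(-3/8)` works: it
keeps all increments small, yet is wider than the scale `N^(-1/2)` of the solution.

Write `e_i` for the residual. Since the weights are calibrated, the calibration estimator minus the
regression estimator is `∑_A (ω_i - d_i) e_i`. Its linear part is the inner product of `λ - λ₀` with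
`∑_A e_i z_i / g'(d_i)`. This sample sum estimates the total of `π_i e_i z_i / g'(d_i)`, which
vanishes by the normal equations for `γ_N`, hence it is `o_p(N)`. The remainder is at most a small
multiple of `‖λ - λ₀‖ N`. The difference is thus `o_p(√N)`, while the variance of the regression
estimator is at least of order `N`.

The regression error is a linear combination, with coefficients `(-1, γ_N)`, of the Horvitz–Thompson
errors of `(y, z)`. The coefficients vary with `N` and need not converge. After standardization they
are unit vectors, and compactness of the sphere together with a uniform Lipschitz bound on
characteristic functions gives the normal limit (`tendstoInDistribution_dotProduct`). Slutsky's
theorem transfers it to the calibration estimator. Conversely, the standard normal law determines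
its nonnegative scale, so any other valid standardization is asymptotically equivalent
(`tendsto_one_of_tendstoInDistribution_mul`). -/

noncomputable section

/-! ### Second moments of Horvitz–Thompson errors. -/

namespace SamplingDesign

variable {N : ℕ} (D : SamplingDesign N)

/-- The centred, inverse-probability weighted indicator `1 - δ_i / π_i`. -/
def dev (i : Fin N) (A : Finset (Fin N)) : ℝ := 1 - δ i A / D.incl i

theorem integrable {E : Type*} [NormedAddCommGroup E] (X : Finset (Fin N) → E) :
    Integrable X D.law := Integrable.of_finite

theorem integral_δ (i : Fin N) : ∫ A, δ i A ∂D.law = D.incl i := by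
  have h : (fun A => δ i A) = Set.indicator {A : Finset (Fin N) | i ∈ A} 1 := by
    ext A; simp [δ, Set.indicator]
  rw [h, integral_indicator_one .of_discrete, incl]

theorem integral_δ_mul_δ (i j : Fin N) : ∫ A, δ i A * δ j A ∂D.law = D.incl₂ i j := by
  have h : (fun A => δ i A * δ j A) =
      Set.indicator {A : Finset (Fin N) | i ∈ A ∧ j ∈ A} 1 := by
    ext A
    by_cases hi : i ∈ A <;> by_cases hj : j ∈ A <;> simp [δ, Set.indicator, hi, hj]
  rw [h, integral_indicator_one .of_discrete, incl₂]

theorem incl₂_self (i : Fin N) : D.incl₂ i i = D.incl i := by simp [incl, incl₂]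

theorem incl_le_one (i : Fin N) : D.incl i ≤ 1 := measureReal_le_one

theorem incl_nonneg (i : Fin N) : 0 ≤ D.incl i := measureReal_nonneg

theorem Δ_comm (i j : Fin N) : D.Δ i j = D.Δ j i := by
  simp only [Δ, incl₂, and_comm, mul_comm]

theorem size_eq : D.size = ∑ i, D.incl i := by
  simp_rw [← integral_δ]
  rw [← integral_finsetSum _ fun i _ => D.integrable _]
  simp [size, δ]

variable {D} (hD : ∀ i, 0 < D.incl i)
include hD

theorem integral_dev_mul_dev (i j : Fin N) :
    ∫ A, D.dev i A * D.dev j A ∂D.law = D.Δ i j / (D.incl i * D.incl j) := by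
  have h : (fun A => D.dev i A * D.dev j A) = fun A =>
      1 - (D.incl i)⁻¹ * δ i A - (D.incl j)⁻¹ * δ j A
        + (D.incl i * D.incl j)⁻¹ * (δ i A * δ j A) := by
    ext A
    have := (hD i).ne'
    have := (hD j).ne'
    simp only [dev]
    field_simp
    ring
  rw [h, integral_add (D.integrable _) (D.integrable _),
    integral_sub (D.integrable _) (D.integrable _), integral_sub (D.integrable _) (D.integrable _),
    integral_const_mul, integral_const_mul, integral_const_mul, integral_δ, integral_δ,
    integral_δ_mul_δ, Δ]
  have := (hD i).ne'
  have := (hD j).ne'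
  simp
  field_simp
  ring

theorem integral_dev (i : Fin N) : ∫ A, D.dev i A ∂D.law = 0 := by
  have := (hD i).ne'
  simp only [dev]
  rw [integral_sub (D.integrable _) (D.integrable _), integral_div, integral_δ]
  simp [this]

theorem integral_norm_sum_dev_sq {E : Type*} [NormedAddCommGroup E] [InnerProductSpace ℝ E]
    (w : Fin N → E) :
    ∫ A, ‖∑ i, D.dev i A • w i‖ ^ 2 ∂D.law =
      ∑ i, ∑ j, D.Δ i j / (D.incl i * D.incl j) * inner ℝ (w i) (w j) := by
  simp_rw [← real_inner_self_eq_norm_sq, sum_inner, inner_sum, real_inner_smul_left,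
    real_inner_smul_right, ← mul_assoc]
  rw [integral_finsetSum _ fun i _ => D.integrable _]
  refine Finset.sum_congr rfl fun i _ => ?_
  rw [integral_finsetSum _ fun i _ => D.integrable _]
  refine Finset.sum_congr rfl fun j _ => ?_
  rw [integral_mul_const, integral_dev_mul_dev hD]

/-- Under weak dependence, Horvitz–Thompson sums have mean square of the order of the sum of
squares. -/
theorem integral_norm_sum_dev_sq_le {E : Type*} [NormedAddCommGroup E] [InnerProductSpace ℝ E]
    (w : Fin N → E) {c C : ℝ} (hc : ∀ i, (D.incl i)⁻¹ ≤ c) (hc0 : 0 ≤ c)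
    (hC : ∀ i j, i ≠ j → (N : ℝ) * |D.Δ i j| ≤ C) (hC0 : 0 ≤ C) :
    ∫ A, ‖∑ i, D.dev i A • w i‖ ^ 2 ∂D.law ≤ (c + C * c ^ 2) * ∑ i, ‖w i‖ ^ 2 := by
  rw [integral_norm_sum_dev_sq hD]
  rcases Nat.eq_zero_or_pos N with rfl | hN
  · simp
  have hN' : (0 : ℝ) < N := by exact_mod_cast hN
  -- On the diagonal `Δ_ii / π_i² = (1 - π_i) / π_i ≤ c`. Off the diagonal weak dependence supplies
  -- a factor `1 / N`, which cancels the `N` produced by Cauchy–Schwarz applied to `(∑ ‖w i‖)²`.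
  have key : ∀ i j, D.Δ i j / (D.incl i * D.incl j) * inner ℝ (w i) (w j) ≤
      (if i = j then c * ‖w i‖ ^ 2 else 0) + C * c ^ 2 / N * (‖w i‖ * ‖w j‖) := by
    intro i j
    by_cases hij : i = j
    · subst hij
      rw [if_pos rfl, real_inner_self_eq_norm_sq]
      have h1 : D.Δ i i / (D.incl i * D.incl i) ≤ c := by
        refine le_trans ?_ (hc i)
        rw [Δ, incl₂_self, div_le_iff₀ (mul_pos (hD i) (hD i))]
        have := (hD i).ne'
        field_simp
        nlinarith [hD i]
      have h2 : 0 ≤ C * c ^ 2 / N * (‖w i‖ * ‖w i‖) := by positivity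
      nlinarith [mul_le_mul_of_nonneg_right h1 (sq_nonneg ‖w i‖)]
    · rw [if_neg hij, zero_add]
      refine (le_abs_self _).trans ?_
      rw [abs_mul]
      have h1 : |D.Δ i j / (D.incl i * D.incl j)| ≤ C * c ^ 2 / N := by
        rw [abs_div, abs_of_pos (mul_pos (hD i) (hD j)), div_eq_mul_inv, mul_inv]
        have h3 : |D.Δ i j| ≤ C / N := by
          rw [le_div_iff₀ hN', mul_comm]; exact hC i j hij
        have h4 : (D.incl i)⁻¹ * (D.incl j)⁻¹ ≤ c * c :=
          mul_le_mul (hc i) (hc j) (inv_nonneg.2 (hD j).le) hc0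
        calc _ ≤ C / N * (c * c) :=
              mul_le_mul h3 h4 (mul_nonneg (inv_nonneg.2 (hD i).le) (inv_nonneg.2 (hD j).le))
                (by positivity)
          _ = _ := by ring
      exact mul_le_mul h1 (abs_real_inner_le_norm _ _) (abs_nonneg _) (by positivity)
  calc _ ≤ ∑ i, ∑ j, ((if i = j then c * ‖w i‖ ^ 2 else 0)
        + C * c ^ 2 / N * (‖w i‖ * ‖w j‖)) :=
        Finset.sum_le_sum fun i _ => Finset.sum_le_sum fun j _ => key i j
    _ = c * ∑ i, ‖w i‖ ^ 2 + C * c ^ 2 / N * (∑ i, ‖w i‖) ^ 2 := by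
        simp_rw [Finset.sum_add_distrib]
        simp only [Finset.sum_ite_eq, Finset.mem_univ, if_true]
        rw [← Finset.mul_sum, sq (∑ i, ‖w i‖), Finset.sum_mul_sum]
        simp_rw [Finset.mul_sum]
    _ ≤ c * ∑ i, ‖w i‖ ^ 2 + C * c ^ 2 / N * (N * ∑ i, ‖w i‖ ^ 2) := by
        have := sq_sum_le_card_mul_sum_sq (s := Finset.univ) (f := fun i : Fin N => ‖w i‖)
        rw [Finset.card_univ, Fintype.card_fin] at this
        gcongr
    _ = _ := by field_simp

omit hD in
theorem measureReal_norm_ge_le {E : Type*} [NormedAddCommGroup E] (X : Finset (Fin N) → E)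
    {a : ℝ} (ha : 0 < a) :
    D.law.real {A | a ≤ ‖X A‖} ≤ (∫ A, ‖X A‖ ^ 2 ∂D.law) / a ^ 2 := by
  rw [le_div_iff₀ (by positivity), mul_comm]
  have h := mul_meas_ge_le_integral_of_nonneg (μ := D.law) (f := fun A => ‖X A‖ ^ 2)
    (ae_of_all _ fun A => sq_nonneg _) (D.integrable _) (a ^ 2)
  have hs : {A | a ^ 2 ≤ ‖X A‖ ^ 2} = {A | a ≤ ‖X A‖} := by
    ext A
    exact pow_le_pow_iff_left₀ ha.le (norm_nonneg _) two_ne_zero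
  rwa [hs] at h

-- Separates a weighted sample sum into its population total and a centred error. It serves for the
-- calibration defect at `λ₀`, for the sample second moment matrix and for the linear part of the
-- weight expansion.
omit hD in
theorem sum_smul_eq_sub_sum_dev {E : Type*} [AddCommGroup E] [Module ℝ E]
    (w : Fin N → E) (A : Finset (Fin N)) :
    ∑ i ∈ A, (D.incl i)⁻¹ • w i = ∑ i, w i - ∑ i, D.dev i A • w i := by
  rw [← Finset.sum_sub_distrib, ← Finset.sum_filter_add_sum_filter_not Finset.univ (· ∈ A)]
  simp only [Finset.filter_univ_mem]
  rw [Finset.sum_congr (s₂ := Finset.univ.filter (· ∉ A)) (g := fun _ => (0 : E)) rfl]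
  · simp only [Finset.sum_const_zero, add_zero]
    refine Finset.sum_congr rfl fun i hi => ?_
    simp [dev, δ, hi, sub_smul]
  · intro i hi
    simp only [Finset.mem_filter] at hi
    simp [dev, δ, hi.2]

theorem variance_sum_dev (w : Fin N → ℝ) (c : ℝ) :
    variance (fun A => c + ∑ i, D.dev i A * w i) D.law =
      ∑ i, ∑ j, D.Δ i j * (w i / D.incl i) * (w j / D.incl j) := by
  have h0 : ∫ A, (∑ i, D.dev i A * w i) ∂D.law = 0 := by
    rw [integral_finsetSum _ fun i _ => D.integrable _]
    refine Finset.sum_eq_zero fun i _ => ?_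
    rw [integral_mul_const, integral_dev hD, zero_mul]
  have h := integral_norm_sum_dev_sq hD w
  rw [variance_eq_integral (by exact Measurable.of_discrete.aemeasurable),
    integral_add (D.integrable _) (D.integrable _), h0]
  simp only [integral_const, probReal_univ, one_smul, add_zero, add_sub_cancel_left]
  simp only [smul_eq_mul, Real.norm_eq_abs, sq_abs] at h
  rw [h]
  refine Finset.sum_congr rfl fun i _ => Finset.sum_congr rfl fun j _ => ?_
  have := (hD i).ne'
  have := (hD j).ne'
  simp only [RCLike.inner_apply, conj_trivial]
  field_simp

end SamplingDesign

/-! ### The entropy, its conjugate, and optimality of calibrated weights. -/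

namespace EntropyCalibration

variable {p : ℕ} {S : EntropyCalibration p}

namespace RegularEntropy

variable (hS : S.RegularEntropy) (hV : S.V.Nontrivial)
include hS hV

theorem uniqueDiffOn : UniqueDiffOn ℝ S.V :=
  uniqueDiffOn_convex hS.interval.convex (hS.interval.convex.nontrivial_iff_nonempty_interior.1 hV)

omit hV in
theorem hasDerivWithinAt_G {v : ℝ} (hv : v ∈ S.V) : HasDerivWithinAt S.G (S.g v) S.V v :=
  (hS.contDiff.differentiableOn (by norm_num) v hv).hasDerivWithinAt

theorem contDiffOn_g : ContDiffOn ℝ 1 S.g S.V :=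
  hS.contDiff.derivWithin (hS.uniqueDiffOn hV) (by norm_num)

theorem hasDerivWithinAt_g {v : ℝ} (hv : v ∈ S.V) : HasDerivWithinAt S.g (S.g' v) S.V v :=
  ((hS.contDiffOn_g hV).differentiableOn (by norm_num) v hv).hasDerivWithinAt

theorem continuousOn_g : ContinuousOn S.g S.V := (hS.contDiffOn_g hV).continuousOn

theorem continuousOn_g' : ContinuousOn S.g' S.V :=
  (hS.contDiffOn_g hV).continuousOn_derivWithin (hS.uniqueDiffOn hV) le_rfl

theorem strictMonoOn_g : StrictMonoOn S.g S.V :=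
  strictMonoOn_of_hasDerivWithinAt_pos hS.interval.convex (hS.continuousOn_g hV)
    (fun _ hv => (hS.hasDerivWithinAt_g hV (interior_subset hv)).mono interior_subset)
    fun v hv => hS.deriv_pos v (interior_subset hv)

-- Convexity compares the one-sided slopes with the derivative within `V`, so endpoints of `V` are
-- allowed.
omit hV in
theorem add_g_mul_sub_le {a b : ℝ} (ha : a ∈ S.V) (hb : b ∈ S.V) :
    S.G a + S.g a * (b - a) ≤ S.G b := by
  have hd := hS.hasDerivWithinAt_G ha
  rcases lt_trichotomy a b with h | rfl | h
  · have := hS.strictConvex.convexOn.le_slope_of_hasDerivWithinAt ha hb h hd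
    rw [slope_def_field, le_div_iff₀ (sub_pos.2 h)] at this
    linarith
  · simp
  · have := hS.strictConvex.convexOn.slope_le_of_hasDerivWithinAt hb ha h hd
    rw [slope_def_field, div_le_iff₀ (sub_pos.2 h)] at this
    linarith

theorem ordConnected_image_g : (S.g '' S.V).OrdConnected :=
  (hS.interval.isPreconnected.image _ (hS.continuousOn_g hV)).ordConnected

theorem gInv_g {v : ℝ} (hv : v ∈ S.V) : S.gInv (S.g v) = v :=
  (hS.strictMonoOn_g hV).injOn.leftInvOn_invFunOn hv

theorem strictMonoOn_gInv : StrictMonoOn S.gInv (S.g '' S.V) := by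
  rintro _ ⟨a, ha, rfl⟩ _ ⟨b, hb, rfl⟩ h
  rw [hS.gInv_g hV ha, hS.gInv_g hV hb]
  exact ((hS.strictMonoOn_g hV).lt_iff_lt ha hb).1 h

/-- A strictly increasing bijection between order-connected sets is an order isomorphism, hence a
homeomorphism. -/
theorem continuousOn_gInv : ContinuousOn S.gInv (S.g '' S.V) := by
  have := hS.interval
  have := hS.ordConnected_image_g hV
  have hc := ((hS.strictMonoOn_g hV).orderIso S.g S.V).symm.continuous
  rw [continuousOn_iff_continuous_domRestrict]
  convert continuous_subtype_val.comp hc using 1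
  ext ⟨t, v, hv, rfl⟩
  have : (⟨S.g v, v, hv, rfl⟩ : S.g '' S.V) = (hS.strictMonoOn_g hV).orderIso S.g S.V ⟨v, hv⟩ := rfl
  simp only [Set.domRestrict_apply, Function.comp_apply]
  rw [this, OrderIso.symm_apply_apply, hS.gInv_g hV hv]

omit hS hV in
theorem gInv_mem {t : ℝ} (ht : t ∈ S.g '' S.V) : S.gInv t ∈ S.V :=
  Function.invFunOn_mem ht

omit hS hV in
theorem g_gInv {t : ℝ} (ht : t ∈ S.g '' S.V) : S.g (S.gInv t) = t :=
  Function.invFunOn_eq ht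

/-- `V` may contain endpoints, so the derivative is taken within `g(V)`: the slopes of the inverse
are the reciprocals of the slopes of `g`. -/
theorem hasDerivWithinAt_gInv {t : ℝ} (ht : t ∈ S.g '' S.V) :
    HasDerivWithinAt S.gInv (S.g' (S.gInv t))⁻¹ (S.g '' S.V) t := by
  have hd := hS.hasDerivWithinAt_g hV (gInv_mem ht)
  rw [hasDerivWithinAt_iff_tendsto_slope] at hd ⊢
  have hmap : Tendsto S.gInv (𝓝[(S.g '' S.V) \ {t}] t) (𝓝[S.V \ {S.gInv t}] (S.gInv t)) := by
    refine tendsto_nhdsWithin_iff.2 ⟨?_, ?_⟩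
    · exact (hS.continuousOn_gInv hV t ht).mono_left (nhdsWithin_mono _ Set.sdiff_subset)
    · filter_upwards [self_mem_nhdsWithin] with s hs
      exact ⟨gInv_mem hs.1, fun h => hs.2 ((hS.strictMonoOn_gInv hV).injOn hs.1 ht h)⟩
  refine ((hd.comp hmap).inv₀ (hS.deriv_pos _ (gInv_mem ht)).ne').congr' ?_
  filter_upwards [self_mem_nhdsWithin] with s hs
  simp only [Function.comp_apply, slope_def_field, g_gInv hs.1, g_gInv ht, inv_div]

theorem continuousOn_F : ContinuousOn S.F (S.g '' S.V) := by
  refine ContinuousOn.add (ContinuousOn.neg ?_) ((hS.continuousOn_gInv hV).mul continuousOn_id)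
  exact hS.contDiff.continuousOn.comp (hS.continuousOn_gInv hV) fun t ht => gInv_mem ht

-- This is the tangent inequality for `G` at `gInv s`, evaluated at `gInv t` and rewritten for the
-- conjugate. It makes `gInv` a subgradient of `F`, which is all that the dual problem requires;
-- differentiability of `F` is not needed.
omit hV in
theorem gInv_mul_sub_le {s t : ℝ} (hs : s ∈ S.g '' S.V) (ht : t ∈ S.g '' S.V) :
    S.gInv t * (s - t) ≤ S.F s - S.F t := by
  have := hS.add_g_mul_sub_le (gInv_mem hs) (gInv_mem ht)
  rw [g_gInv hs] at this
  simp only [F]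
  linarith

/-- First-order expansion of `g⁻¹`, uniformly on compact subsets of `g(V)`. -/
theorem exists_gInv_add_sub_le {K : Set ℝ} (hK : IsCompact K) (hKV : K ⊆ S.V) {ε : ℝ}
    (hε : 0 < ε) :
    ∃ η > 0, ∀ a ∈ K, ∀ s, |s| ≤ η → S.g a + s ∈ S.g '' S.V →
      |S.gInv (S.g a + s) - a - s / S.g' a| ≤ ε * |s| := by
  set T := S.g '' S.V with hT
  let φ : T → ℝ := fun t => (S.g' (S.gInv t))⁻¹
  have hφ : Continuous φ := by
    have h1 : ContinuousOn (fun t => (S.g' (S.gInv t))⁻¹) T :=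
      ((hS.continuousOn_g' hV).comp (hS.continuousOn_gInv hV) fun t ht => gInv_mem ht).inv₀
        fun t ht => (hS.deriv_pos _ (gInv_mem ht)).ne'
    exact continuousOn_iff_continuous_domRestrict.1 h1
  have hKT : IsCompact ((↑) ⁻¹' (S.g '' K) : Set T) := by
    refine Topology.IsInducing.subtypeVal.isCompact_preimage' ?_ ?_
    · exact hK.image_of_continuousOn ((hS.continuousOn_g hV).mono hKV)
    · rw [Subtype.range_coe]; exact Set.image_mono hKV
  -- Only one of the two points compared is confined to the compact set; the other may be any nearby
  -- point of `g(V)`, such as those between `g a` and `g a + s`.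
  have hu := hKT.uniformContinuousAt_of_continuousAt φ (fun t _ => hφ.continuousAt)
    (Metric.dist_mem_uniformity hε)
  obtain ⟨η, hη, hη'⟩ := Metric.mem_uniformity_dist.1 hu
  refine ⟨η / 2, half_pos hη, fun a ha s hs hsT => ?_⟩
  have haV := hKV ha
  have haT : S.g a ∈ T := ⟨a, haV, rfl⟩
  have hseg : Set.uIcc (S.g a) (S.g a + s) ⊆ T :=
    (hS.ordConnected_image_g hV).uIcc_subset haT hsT
  -- Mean value inequality for `gInv` minus the linear function with slope `1 / g'(a)`: the
  -- derivative of the difference is at most `ε` on the segment.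
  have hder : ∀ t ∈ Set.uIcc (S.g a) (S.g a + s),
      HasDerivWithinAt (fun t => S.gInv t - t * (S.g' a)⁻¹)
        ((S.g' (S.gInv t))⁻¹ - 1 * (S.g' a)⁻¹) (Set.uIcc (S.g a) (S.g a + s)) t := fun t ht =>
    ((hS.hasDerivWithinAt_gInv hV (hseg ht)).mono hseg).sub
      ((hasDerivWithinAt_id t _).mul_const _)
  have hbound : ∀ t ∈ Set.uIcc (S.g a) (S.g a + s),
      ‖(S.g' (S.gInv t))⁻¹ - 1 * (S.g' a)⁻¹‖ ≤ ε := by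
    intro t ht
    have h1 : |t - S.g a| ≤ |S.g a + s - S.g a| := Set.abs_sub_left_of_mem_uIcc ht
    rw [add_sub_cancel_left] at h1
    have h2 : dist (φ ⟨S.g a, haT⟩) (φ ⟨t, hseg ht⟩) < ε := @hη' ⟨S.g a, haT⟩ ⟨t, hseg ht⟩ (by
      rw [dist_comm, Subtype.dist_eq, Real.dist_eq]; linarith) ⟨a, ha, rfl⟩
    rw [dist_comm, Real.dist_eq] at h2
    simp only [φ, hS.gInv_g hV haV] at h2
    rw [one_mul, Real.norm_eq_abs]
    exact h2.le
  have := Convex.norm_image_sub_le_of_norm_hasDerivWithin_le hder hbound (convex_uIcc _ _)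
    Set.left_mem_uIcc Set.right_mem_uIcc
  rw [hS.gInv_g hV haV, add_sub_cancel_left, Real.norm_eq_abs, Real.norm_eq_abs] at this
  convert this using 2
  ring

-- Weak duality: summing the tangent inequalities at the proposed weights leaves the linear term `l
-- ⬝ᵥ ∑ (ω_i - ω̂_i) z_i`, which vanishes because both weight vectors satisfy the same constraints.
omit hV in
theorem isCalibrated_of_multiplier {N : ℕ} {A : Finset (Fin N)} {l : Fin p ⊕ Unit → ℝ}
    (hl : ∀ i ∈ A, l ⬝ᵥ S.z N i ∈ S.g '' S.V)
    (hcal : ∑ i ∈ A, S.gInv (l ⬝ᵥ S.z N i) • S.z N i = ∑ i, S.z N i) :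
    S.IsCalibrated N A fun i => S.gInv (l ⬝ᵥ S.z N i) := by
  have hmem : (fun i : A => S.gInv (l ⬝ᵥ S.z N i)) ∈ S.feasible N A := by
    refine ⟨fun i => gInv_mem (hl i i.2), ?_⟩
    rw [← hcal, ← Finset.sum_coe_sort A]
  refine ⟨hmem, fun ω hω => ?_⟩
  have h1 : ∀ i : A, S.G (S.gInv (l ⬝ᵥ S.z N i)) +
      l ⬝ᵥ (ω i • S.z N i - S.gInv (l ⬝ᵥ S.z N i) • S.z N i) ≤ S.G (ω i) := by
    intro i
    have := hS.add_g_mul_sub_le (gInv_mem (hl i i.2)) (hω.1 i)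
    rw [g_gInv (hl i i.2)] at this
    rw [dotProduct_sub, dotProduct_smul, dotProduct_smul, smul_eq_mul, smul_eq_mul]
    linarith
  have h2 := Finset.sum_le_sum fun i (_ : i ∈ Finset.univ) => h1 i
  rw [Finset.sum_add_distrib, ← dotProduct_sum, Finset.sum_sub_distrib, hω.2, hmem.2, sub_self,
    dotProduct_zero, add_zero] at h2
  exact h2

-- The midpoint of two distinct minimizers would be feasible with a strictly smaller objective.
omit hV in
theorem isCalibrated_unique {N : ℕ} {A : Finset (Fin N)} {ω ω' : A → ℝ}
    (h : S.IsCalibrated N A ω) (h' : S.IsCalibrated N A ω') : ω = ω' := by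
  by_contra hne
  obtain ⟨i₀, hi₀⟩ := Function.ne_iff.1 hne
  let m : A → ℝ := fun i => (1 / 2 : ℝ) • ω i + (1 / 2 : ℝ) • ω' i
  have hm : m ∈ S.feasible N A := by
    refine ⟨fun i => hS.interval.convex (h.1.1 i) (h'.1.1 i) (by norm_num) (by norm_num)
      (by norm_num), ?_⟩
    simp only [m, add_smul, smul_assoc]
    rw [Finset.sum_add_distrib, ← Finset.smul_sum, ← Finset.smul_sum, h.1.2, h'.1.2, ← add_smul]
    norm_num
  have hlt : ∑ i, S.G (m i) < ∑ i, ((1 / 2 : ℝ) • S.G (ω i) + (1 / 2 : ℝ) • S.G (ω' i)) := by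
    refine Finset.sum_lt_sum (fun i _ => hS.strictConvex.convexOn.2 (h.1.1 i) (h'.1.1 i)
      (by norm_num) (by norm_num) (by norm_num)) ⟨i₀, Finset.mem_univ _, ?_⟩
    exact hS.strictConvex.2 (h.1.1 i₀) (h'.1.1 i₀) hi₀ (by norm_num) (by norm_num) (by norm_num)
  rw [Finset.sum_add_distrib, ← Finset.smul_sum, ← Finset.smul_sum] at hlt
  have h1 : ∑ i, S.G (ω i) ≤ ∑ i, S.G (m i) := h.2 hm
  have h2 : ∑ i, S.G (ω' i) ≤ ∑ i, S.G (m i) := h'.2 hm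
  simp only [smul_eq_mul] at hlt
  linarith

end RegularEntropy

end EntropyCalibration

/-! ### Zeros of monotone gradient maps and solvability for the multiplier. -/

section Multiplier

variable {E : Type*} [NormedAddCommGroup E] [InnerProductSpace ℝ E]

/-- A minimizer over a ball of a function with
continuous subgradient satisfies the variational inequality. -/
theorem inner_sub_nonneg_of_isMinOn_of_subgradient {B : Set E} (hB : Convex ℝ B) {Q : E → ℝ}
    {U : E → E} (hU : ContinuousOn U B)
    (hQ : ∀ x ∈ B, ∀ y ∈ B, inner ℝ (U x) (y - x) ≤ Q y - Q x) {x y : E} (hx : x ∈ B)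
    (hy : y ∈ B) (hmin : IsMinOn Q B x) : 0 ≤ inner ℝ (U x) (y - x) := by
  have hpath : ∀ t ∈ Set.Icc (0 : ℝ) 1, x + t • (y - x) ∈ B := fun t ht =>
    hB.add_smul_sub_mem hx hy ht
  have hcont : ContinuousOn (fun t : ℝ => inner ℝ (U (x + t • (y - x))) (y - x))
      (Set.Icc 0 1) :=
    ContinuousOn.inner (𝕜 := ℝ) (hU.comp (by fun_prop) hpath) continuousOn_const
  have h0 := (hcont 0 ⟨le_rfl, zero_le_one⟩).mono (Set.Ioc_subset_Icc_self)
  simp only [ContinuousWithinAt, zero_smul, add_zero] at h0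
  have : (𝓝[Set.Ioc (0 : ℝ) 1] 0).NeBot := by
    rw [nhdsWithin_Ioc_eq_nhdsGT zero_lt_one]; infer_instance
  refine ge_of_tendsto h0 ?_
  filter_upwards [self_mem_nhdsWithin] with t ht
  have hm := hpath t ⟨ht.1.le, ht.2⟩
  -- The subgradient at an intermediate point of the segment is tested against `x`. Minimality gives
  -- the sign, division by `t` removes the length, and continuity of `U` allows `t → 0`.
  have h1 := hQ _ hm _ hx
  have h2 : Q x ≤ Q (x + t • (y - x)) := hmin hm
  rw [sub_add_cancel_left, ← smul_neg, real_inner_smul_right, inner_neg_right] at h1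
  have h3 : 0 ≤ t * inner ℝ (U (x + t • (y - x))) (y - x) := by linarith
  exact nonneg_of_mul_nonneg_right h3 ht.1

/-- A strongly monotone continuous gradient which is small at the centre of a ball vanishes
in the ball. -/
theorem exists_eq_zero_of_strongly_monotone [FiniteDimensional ℝ E] {x₀ : E} {r κ : ℝ}
    (hr : 0 < r) (hκ : 0 < κ) {Q : E → ℝ} {U : E → E}
    (hQc : ContinuousOn Q (Metric.closedBall x₀ r)) (hU : ContinuousOn U (Metric.closedBall x₀ r))
    (hQ : ∀ x ∈ Metric.closedBall x₀ r, ∀ y ∈ Metric.closedBall x₀ r,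
      inner ℝ (U x) (y - x) ≤ Q y - Q x)
    (hmono : ∀ x ∈ Metric.closedBall x₀ r, κ * ‖x - x₀‖ ^ 2 ≤ inner ℝ (U x - U x₀) (x - x₀))
    (h0 : ‖U x₀‖ < κ * r) :
    ∃ x ∈ Metric.closedBall x₀ r, κ * ‖x - x₀‖ ≤ ‖U x₀‖ ∧ U x = 0 := by
  obtain ⟨x, hx, hmin⟩ := (isCompact_closedBall x₀ r).exists_isMinOn
    (Metric.nonempty_closedBall.2 hr.le) hQc
  have hc : x₀ ∈ Metric.closedBall x₀ r := Metric.mem_closedBall_self hr.le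
  have hvi : ∀ y ∈ Metric.closedBall x₀ r, 0 ≤ inner ℝ (U x) (y - x) := fun y hy =>
    inner_sub_nonneg_of_isMinOn_of_subgradient (convex_closedBall _ _) hU hQ hx hy hmin
  have hdist : κ * ‖x - x₀‖ ≤ ‖U x₀‖ := by
    -- The variational inequality tested at the centre, combined with strong monotonicity, bounds
    -- the distance of the minimizer; with `h0` this places it in the open ball.
    have h1 := hvi x₀ hc
    have h2 := hmono x hx
    rw [inner_sub_left] at h2
    rw [← neg_sub, inner_neg_right] at h1
    have h3 := neg_le_of_abs_le (abs_real_inner_le_norm (U x₀) (x - x₀))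
    rcases (norm_nonneg (x - x₀)).eq_or_lt with h | h
    · rw [← h, mul_zero]; exact norm_nonneg _
    · refine le_of_mul_le_mul_right ?_ h
      nlinarith
  refine ⟨x, hx, hdist, ?_⟩
  have hlt : ‖x - x₀‖ < r := lt_of_mul_lt_mul_left (hdist.trans_lt h0) hκ.le
  by_contra hne
  have hpos : 0 < ‖U x‖ := norm_pos_iff.2 hne
  -- The largest step for which the triangle inequality keeps `x - t • U x` in the ball. There the
  -- variational inequality reads `0 ≤ -t ‖U x‖²`.
  set t := (r - ‖x - x₀‖) / ‖U x‖ with ht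
  have htpos : 0 < t := div_pos (sub_pos.2 hlt) hpos
  have hy : x - t • U x ∈ Metric.closedBall x₀ r := by
    rw [Metric.mem_closedBall, dist_eq_norm]
    calc ‖x - t • U x - x₀‖ = ‖(x - x₀) - t • U x‖ := by congr 1; abel
      _ ≤ ‖x - x₀‖ + ‖t • U x‖ := norm_sub_le _ _
      _ = r := by
        rw [norm_smul, Real.norm_of_nonneg htpos.le, ht, div_mul_cancel₀ _ hpos.ne']; ring
  have := hvi _ hy
  rw [sub_sub_cancel_left, inner_neg_right, real_inner_smul_right, real_inner_self_eq_norm_sq]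
    at this
  have : 0 < t * ‖U x‖ ^ 2 := by positivity
  linarith

/-- Solvability of the equation `∑ h(⟨λ, z_i⟩) z_i = b` near `λ₀`, for `h` increasing. -/
theorem exists_multiplier [FiniteDimensional ℝ E] {α : Type*} {s : Finset α} {z : α → E}
    {b l₀ : E} {h F : ℝ → ℝ} {T : Set ℝ} (hh : ContinuousOn h T) (hF : ContinuousOn F T)
    (hsub : ∀ u ∈ T, ∀ t ∈ T, h t * (u - t) ≤ F u - F t) {r κ : ℝ} (hr : 0 < r) (hκ : 0 < κ)
    (hT : ∀ l ∈ Metric.closedBall l₀ r, ∀ i ∈ s, inner ℝ l (z i) ∈ T)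
    (hmono : ∀ l ∈ Metric.closedBall l₀ r, κ * ‖l - l₀‖ ^ 2 ≤
      ∑ i ∈ s, (h (inner ℝ l (z i)) - h (inner ℝ l₀ (z i))) * inner ℝ (l - l₀) (z i))
    (h0 : ‖∑ i ∈ s, h (inner ℝ l₀ (z i)) • z i - b‖ < κ * r) :
    ∃ l ∈ Metric.closedBall l₀ r,
      κ * ‖l - l₀‖ ≤ ‖∑ i ∈ s, h (inner ℝ l₀ (z i)) • z i - b‖ ∧
      ∑ i ∈ s, h (inner ℝ l (z i)) • z i = b := by
  obtain ⟨l, hl, h1, h2⟩ := exists_eq_zero_of_strongly_monotone (x₀ := l₀) (r := r) (κ := κ) hr hκ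
    (Q := fun l => ∑ i ∈ s, F (inner ℝ l (z i)) - inner ℝ b l)
    (U := fun l => ∑ i ∈ s, h (inner ℝ l (z i)) • z i - b)
    (by
      refine ContinuousOn.sub (continuousOn_finsetSum _ fun i hi => ?_) (by fun_prop)
      exact hF.comp (by fun_prop) fun l hl => hT l hl i hi)
    (by
      refine ContinuousOn.sub (continuousOn_finsetSum _ fun i hi => ?_) continuousOn_const
      exact (hh.comp (by fun_prop) fun l hl => hT l hl i hi).smul continuousOn_const)
    (by
      intro x hx y hy
      rw [inner_sub_left, sum_inner, inner_sub_right b]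
      have : ∑ i ∈ s, inner ℝ (h (inner ℝ x (z i)) • z i) (y - x) ≤
          ∑ i ∈ s, (F (inner ℝ y (z i)) - F (inner ℝ x (z i))) := by
        refine Finset.sum_le_sum fun i hi => ?_
        rw [real_inner_smul_left, inner_sub_right, real_inner_comm y, real_inner_comm x]
        exact hsub _ (hT y hy i hi) _ (hT x hx i hi)
      rw [Finset.sum_sub_distrib] at this
      linarith)
    (by
      intro x hx
      refine (hmono x hx).trans_eq ?_
      rw [sub_sub_sub_cancel_right, ← Finset.sum_sub_distrib, sum_inner]
      refine Finset.sum_congr rfl fun i _ => ?_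
      rw [← sub_smul, real_inner_smul_left, real_inner_comm (x - l₀)])
    h0
  exact ⟨l, hl, h1, sub_eq_zero.1 h2⟩

/-- If the points of a neighbourhood of `x₀` eventually belong to convex sets `C N`, then so does
a whole ball, uniformly. -/
theorem exists_ball_eventually_subset [FiniteDimensional ℝ E] {C : ℕ → Set E}
    (hC : ∀ N, Convex ℝ (C N)) {x₀ : E} (h : ∀ᶠ x in 𝓝 x₀, ∀ᶠ N in atTop, x ∈ C N) :
    ∃ r > 0, ∀ᶠ N in atTop, Metric.closedBall x₀ r ⊆ C N := by
  -- A neighbourhood of `x₀` lies in the convex hull of finitely many points, and finitely many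
  -- "eventually" statements hold simultaneously.
  obtain ⟨b, hb, hb'⟩ := exists_mem_interior_convexHull_affineBasis h
  obtain ⟨r, hr, hball⟩ := Metric.nhds_basis_closedBall.mem_iff.1 (mem_interior_iff_mem_nhds.1 hb)
  have hall : ∀ᶠ N in atTop, ∀ k, b k ∈ C N :=
    eventually_all.2 fun k => hb' (subset_convexHull _ _ ⟨k, rfl⟩)
  refine ⟨r, hr, hall.mono fun N hN => hball.trans ?_⟩
  exact convexHull_min (Set.range_subset_iff.2 hN) (hC N)

end Multiplier

/-! ### The unit sphere, and standard normal limits on varying probability spaces. -/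

theorem isCompact_setOf_dotProduct_self_eq_one (ι : Type*) [Fintype ι] :
    IsCompact {v : ι → ℝ | v ⬝ᵥ v = 1} := by
  refine Metric.isCompact_of_isClosed_isBounded (isClosed_eq (by fun_prop) continuous_const) ?_
  refine (Metric.isBounded_closedBall (x := (0 : ι → ℝ)) (r := 1)).subset fun v hv => ?_
  rw [mem_closedBall_zero_iff, pi_norm_le_iff_of_nonneg zero_le_one]
  intro i
  rw [Real.norm_eq_abs, ← sq_le_one_iff_abs_le_one]
  have hv' : ∑ i, v i * v i = 1 := hv
  rw [← hv', sq]
  exact Finset.single_le_sum (f := fun i => v i * v i) (fun j _ => mul_self_nonneg _)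
    (Finset.mem_univ i)

section StandardNormalLimit

variable {Ω : ℕ → Type*} {m : ∀ N, MeasurableSpace (Ω N)} {μ : ∀ N, Measure (Ω N)}
  [∀ N, IsProbabilityMeasure (μ N)]

/-- Lévy's continuity theorem; it replaces couplings, since the sample spaces change with `N`. -/
theorem tendstoInDistribution_gaussianReal_iff {X : ∀ N, Ω N → ℝ}
    (hX : ∀ N, AEMeasurable (X N) (μ N)) :
    TendstoInDistribution X atTop (id : ℝ → ℝ) μ (gaussianReal 0 1) ↔
      ∀ t : ℝ, Tendsto (fun N => ∫ A, Complex.exp (t * X N A * Complex.I) ∂μ N) atTop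
        (𝓝 (Complex.exp (-(t : ℂ) ^ 2 / 2))) := by
  have hc : ∀ t : ℝ, charFun (gaussianReal 0 1) t = Complex.exp (-(t : ℂ) ^ 2 / 2) := by
    intro t
    rw [charFun_gaussianReal]
    congr 1
    push_cast
    ring
  have hN : ∀ (N : ℕ) (t : ℝ), charFun ((μ N).map (X N)) t =
      ∫ A, Complex.exp (t * X N A * Complex.I) ∂μ N := by
    intro N t
    rw [charFun_apply_real, integral_map (hX N) (by fun_prop)]
  constructor
  · intro h t
    have := ProbabilityMeasure.tendsto_iff_tendsto_charFun.1 h.tendsto t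
    simp only [ProbabilityMeasure.coe_mk, Measure.map_id, hc, hN] at this
    exact this
  · intro h
    refine ⟨hX, aemeasurable_id, ProbabilityMeasure.tendsto_iff_tendsto_charFun.2 fun t => ?_⟩
    simp only [ProbabilityMeasure.coe_mk, Measure.map_id, hc, hN]
    exact h t

theorem norm_exp_mul_I_sub_le (t x y : ℝ) :
    ‖Complex.exp (t * x * Complex.I) - Complex.exp (t * y * Complex.I)‖ ≤ |t| * |x - y| := by
  have h1 : Complex.exp (t * x * Complex.I) - Complex.exp (t * y * Complex.I) =
      Complex.exp (t * y * Complex.I) *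
        (Complex.exp (Complex.I * ((t * (x - y) : ℝ) : ℂ)) - 1) := by
    rw [mul_sub, ← Complex.exp_add]
    congr 2
    · push_cast; ring
    · ring
  rw [h1, norm_mul]
  have h2 : ‖Complex.exp (t * y * Complex.I)‖ = 1 := by
    rw [← Complex.ofReal_mul]; exact Complex.norm_exp_ofReal_mul_I _
  rw [h2, one_mul, ← abs_mul]
  exact Real.norm_exp_I_mul_ofReal_sub_one_le

/-- **Slutsky's theorem**, for random variables on varying probability spaces. -/
theorem tendstoInDistribution_gaussianReal_of_sub {X Y : ∀ N, Ω N → ℝ}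
    (hX : TendstoInDistribution X atTop (id : ℝ → ℝ) μ (gaussianReal 0 1))
    (hY : ∀ N, AEMeasurable (Y N) (μ N))
    (hXY : ∀ ε > 0, Tendsto (fun N => (μ N).real {A | ε ≤ |X N A - Y N A|}) atTop (𝓝 0)) :
    TendstoInDistribution Y atTop (id : ℝ → ℝ) μ (gaussianReal 0 1) := by
  have hXm := hX.forall_aemeasurable
  rw [tendstoInDistribution_gaussianReal_iff hXm] at hX
  rw [tendstoInDistribution_gaussianReal_iff hY]
  intro t
  have hint : ∀ N, ∀ Z : Ω N → ℝ, AEMeasurable Z (μ N) →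
      Integrable (fun A => Complex.exp (t * Z A * Complex.I)) (μ N) := by
    intro N Z hZ
    refine Integrable.of_bound (by fun_prop) 1 (ae_of_all _ fun A => ?_)
    rw [← Complex.ofReal_mul, Complex.norm_exp_ofReal_mul_I]
  have hb : ∀ ε > 0, ∀ N, ‖(∫ A, Complex.exp (t * X N A * Complex.I) ∂μ N) -
      ∫ A, Complex.exp (t * Y N A * Complex.I) ∂μ N‖ ≤
        |t| * ε + 2 * (μ N).real {A | ε ≤ |X N A - Y N A|} := by
    intro ε hε N
    have hms : NullMeasurableSet {A | ε ≤ |X N A - Y N A|} (μ N) :=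
      nullMeasurableSet_le aemeasurable_const (by fun_prop)
    rw [← integral_sub (hint N _ (hXm N)) (hint N _ (hY N))]
    refine (norm_integral_le_of_norm_le (g := fun A => |t| * ε +
      Set.indicator {A | ε ≤ |X N A - Y N A|} (fun _ => (2 : ℝ)) A) ?_
      (ae_of_all _ fun A => ?_)).trans_eq ?_
    · exact (integrable_const _).add ((integrable_const _).indicator₀ hms)
    · by_cases hA : ε ≤ |X N A - Y N A|
      · rw [Set.indicator_of_mem (by exact hA)]
        refine (norm_sub_le _ _).trans ?_
        rw [← Complex.ofReal_mul, ← Complex.ofReal_mul, Complex.norm_exp_ofReal_mul_I,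
          Complex.norm_exp_ofReal_mul_I]
        have := mul_nonneg (abs_nonneg t) hε.le
        linarith
      · rw [Set.indicator_of_notMem (by exact hA), add_zero]
        refine (norm_exp_mul_I_sub_le _ _ _).trans ?_
        gcongr
        exact (not_le.1 hA).le
    · rw [integral_add (integrable_const _) ((integrable_const _).indicator₀ hms),
        integral_indicator₀ hms]
      simp [mul_comm]
  rw [tendsto_iff_norm_sub_tendsto_zero] at *
  have hd : Tendsto (fun N => ‖(∫ A, Complex.exp (t * X N A * Complex.I) ∂μ N) -
      ∫ A, Complex.exp (t * Y N A * Complex.I) ∂μ N‖) atTop (𝓝 0) := by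
    rw [Metric.tendsto_atTop']
    intro δ hδ
    set ε := δ / (2 * (|t| + 1)) with hε
    have htp : 0 < |t| + 1 := by positivity
    have hε0 : 0 < ε := by positivity
    have h1 : |t| * ε < δ / 2 := by
      have : (|t| + 1) * ε = δ / 2 := by rw [hε]; field_simp
      nlinarith
    have h2 := ((hXY ε hε0).const_mul 2).eventually_lt_const (show 2 * (0 : ℝ) < δ / 2 by linarith)
    obtain ⟨n, hn⟩ := eventually_atTop.1 h2
    refine ⟨n, fun N hN => ?_⟩
    rw [Real.dist_0_eq_abs, abs_of_nonneg (norm_nonneg _)]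
    have := hb ε hε0 N
    have := hn N hN.le
    linarith
  have hX' := tendsto_iff_norm_sub_tendsto_zero.1 (hX t)
  refine squeeze_zero (fun _ => norm_nonneg _) (fun N => ?_)
    (by simpa using hd.add hX')
  rw [norm_sub_rev (∫ A, Complex.exp (t * X N A * Complex.I) ∂μ N)]
  exact norm_sub_le_norm_sub_add_norm_sub _ _ _

theorem integral_exp_dotProduct_pi_gaussianReal {ι : Type*} [Fintype ι] (a : ι → ℝ)
    (ha : a ⬝ᵥ a = 1) (t : ℝ) :
    ∫ x, Complex.exp (t * (a ⬝ᵥ x : ℝ) * Complex.I) ∂(Measure.pi fun _ : ι => gaussianReal 0 1) =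
      Complex.exp (-(t : ℂ) ^ 2 / 2) := by
  have h1 : ∀ x : ι → ℝ, Complex.exp (t * (a ⬝ᵥ x : ℝ) * Complex.I) =
      ∏ i, Complex.exp ((t * a i : ℝ) * x i * Complex.I) := by
    intro x
    rw [← Complex.exp_sum]
    congr 1
    simp only [dotProduct]
    push_cast
    rw [Finset.mul_sum, Finset.sum_mul]
    refine Finset.sum_congr rfl fun i _ => ?_
    ring
  simp_rw [h1]
  rw [integral_fintype_prod_eq_prod (f := fun i (x : ℝ) =>
    Complex.exp ((t * a i : ℝ) * x * Complex.I))]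
  simp_rw [← charFun_apply_real, charFun_gaussianReal]
  rw [← Complex.exp_sum]
  congr 1
  have h2 : (∑ i, (a i : ℂ) * a i) = 1 := by
    have := congrArg (fun r : ℝ => (r : ℂ)) ha
    simpa [dotProduct] using this
  calc _ = -(t : ℂ) ^ 2 / 2 * ∑ i, (a i : ℂ) * a i := by
        rw [Finset.mul_sum]
        refine Finset.sum_congr rfl fun i _ => ?_
        push_cast
        ring
    _ = _ := by rw [h2, mul_one]

/-- Unit projections, in varying directions, of vectors that converge in distribution
to `N(0, I)`. -/
theorem tendstoInDistribution_dotProduct {ι : Type*} [Fintype ι] {Z : ∀ N, Ω N → ι → ℝ}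
    (hZ : TendstoInDistribution Z atTop (id : (ι → ℝ) → ι → ℝ) μ
      (Measure.pi fun _ : ι => gaussianReal 0 1))
    (hint : ∀ᶠ N in atTop, ∀ v : ι → ℝ, MemLp (fun A => v ⬝ᵥ Z N A) 2 (μ N))
    (hsq : ∀ᶠ N in atTop, ∀ v : ι → ℝ, ∫ A, (v ⬝ᵥ Z N A) ^ 2 ∂μ N ≤ v ⬝ᵥ v)
    {a : ℕ → ι → ℝ} (ha : ∀ᶠ N in atTop, a N ⬝ᵥ a N = 1) :
    TendstoInDistribution (fun N A => a N ⬝ᵥ Z N A) atTop (id : ℝ → ℝ) μ (gaussianReal 0 1) := by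
  have hm : ∀ (v : ι → ℝ) N, AEMeasurable (fun A => v ⬝ᵥ Z N A) (μ N) := fun v N =>
    (show Continuous fun x : ι → ℝ => v ⬝ᵥ x by fun_prop).measurable.comp_aemeasurable
      (hZ.forall_aemeasurable N)
  rw [tendstoInDistribution_gaussianReal_iff fun N => hm (a N) N]
  intro t
  have hexp : ∀ (v : ι → ℝ) N,
      Integrable (fun A => Complex.exp (t * (v ⬝ᵥ Z N A : ℝ) * Complex.I)) (μ N) := by
    intro v N
    refine Integrable.of_bound ((show Measurable fun x : ℝ => Complex.exp (t * x * Complex.I) by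
      fun_prop).comp_aemeasurable (hm v N)).aestronglyMeasurable 1 (ae_of_all _ fun A => ?_)
    rw [← Complex.ofReal_mul, Complex.norm_exp_ofReal_mul_I]
  have hfix : ∀ v : ι → ℝ, v ⬝ᵥ v = 1 →
      Tendsto (fun N => ∫ A, Complex.exp (t * (v ⬝ᵥ Z N A : ℝ) * Complex.I) ∂μ N) atTop
        (𝓝 (Complex.exp (-(t : ℂ) ^ 2 / 2))) := by
    intro v hv
    have h := (ProbabilityMeasure.tendsto_iff_forall_integral_rclike_tendsto ℂ).1 hZ.tendsto
      (BoundedContinuousFunction.ofNormedAddCommGroup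
        (fun x : ι → ℝ => Complex.exp (t * (v ⬝ᵥ x : ℝ) * Complex.I)) (by fun_prop) 1 fun x => by
          rw [← Complex.ofReal_mul, Complex.norm_exp_ofReal_mul_I])
    simp only [ProbabilityMeasure.coe_mk, Measure.map_id,
      BoundedContinuousFunction.coe_ofNormedAddCommGroup] at h
    rw [integral_exp_dotProduct_pi_gaussianReal v hv t] at h
    refine h.congr fun N => ?_
    rw [integral_map (hZ.forall_aemeasurable N) (by fun_prop)]
  have hdiff : ∀ᶠ N in atTop, ∀ v w : ι → ℝ,
      ‖(∫ A, Complex.exp (t * (v ⬝ᵥ Z N A : ℝ) * Complex.I) ∂μ N) -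
        ∫ A, Complex.exp (t * (w ⬝ᵥ Z N A : ℝ) * Complex.I) ∂μ N‖ ≤
      |t| * √((v - w) ⬝ᵥ (v - w)) := by
    filter_upwards [hint, hsq] with N hN hN' v w
    rw [← integral_sub (hexp v N) (hexp w N)]
    have hL := hN (v - w)
    have hL1 : Integrable (fun A => |(v - w) ⬝ᵥ Z N A|) (μ N) :=
      (hL.integrable one_le_two).abs
    refine (norm_integral_le_of_norm_le (hL1.const_mul |t|) (ae_of_all _ fun A => ?_)).trans ?_
    · refine (norm_exp_mul_I_sub_le _ _ _).trans_eq ?_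
      rw [sub_dotProduct]
    · rw [integral_const_mul]
      gcongr
      -- `(E|X|)² ≤ E X²`, from the nonnegativity of the variance of `|X|`.
      refine Real.le_sqrt_of_sq_le (le_trans ?_ (hN' (v - w)))
      have := variance_nonneg (|fun A => (v - w) ⬝ᵥ Z N A|) (μ N)
      rw [variance_eq_sub hL.abs] at this
      simp only [Pi.abs_apply, Pi.pow_apply, sq_abs] at this
      linarith
  -- Along a subsequence the directions converge to a unit vector `v`. The limit for `v` does not
  -- depend on `v`, and the Lipschitz bound `hdiff` replaces the varying direction by `v`.
  refine tendsto_of_subseq_tendsto fun ns hns => ?_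
  obtain ⟨v, hv, ms, hms, hlim⟩ := (isCompact_setOf_dotProduct_self_eq_one ι).tendsto_subseq'
    (x := fun k => a (ns k))
    (hns.eventually ha).frequently
  refine ⟨ms, ?_⟩
  have hsub : Tendsto (fun k => ns (ms k)) atTop atTop := hns.comp hms.tendsto_atTop
  have h0 : Tendsto (fun k => |t| * √((a (ns (ms k)) - v) ⬝ᵥ (a (ns (ms k)) - v))) atTop
      (𝓝 0) := by
    have hc : Continuous fun x : ι → ℝ => |t| * √((x - v) ⬝ᵥ (x - v)) := by fun_prop
    have := (hc.tendsto v).comp hlim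
    rw [sub_self, dotProduct_zero, Real.sqrt_zero, mul_zero] at this
    exact this
  have h1 := squeeze_zero_norm' ((hsub.eventually hdiff).mono fun k hk => hk (a (ns (ms k))) v) h0
  have h2 := h1.add ((hfix v hv).comp hsub)
  simpa using h2

/-- Provides a bounded continuous statistic that identifies the scale `c ≥ 0` of a centred normal
law. Strictness holds because the integrand decreases strictly in `c` except at `x = 0`, a null set.
-/
theorem integral_inv_one_add_sq_strictAntiOn :
    StrictAntiOn (fun c : ℝ => ∫ x, (1 + (c * x) ^ 2)⁻¹ ∂gaussianReal 0 1) (Set.Ici 0) := by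
  intro c hc c' hc' hcc
  have hc0 : 0 ≤ c := hc
  have hint : ∀ c : ℝ, Integrable (fun x : ℝ => (1 + (c * x) ^ 2)⁻¹) (gaussianReal 0 1) := by
    intro c
    refine Integrable.of_bound (by fun_prop) 1 (ae_of_all _ fun x => ?_)
    rw [Real.norm_of_nonneg (by positivity)]
    exact inv_le_one_of_one_le₀ (by nlinarith [sq_nonneg (c * x)])
  have hlt : ∀ x : ℝ, x ≠ 0 → (c * x) ^ 2 < (c' * x) ^ 2 := by
    intro x hx
    rw [mul_pow, mul_pow]
    have : c ^ 2 < c' ^ 2 := by gcongr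
    have : 0 < x ^ 2 := by positivity
    gcongr
  have hsup : {0}ᶜ ⊆ Function.support fun x : ℝ =>
      (1 + (c * x) ^ 2)⁻¹ - (1 + (c' * x) ^ 2)⁻¹ := by
    intro x hx
    refine (sub_pos.2 (inv_strictAnti₀ (by positivity) ?_)).ne'
    linarith [hlt x hx]
  rw [← sub_pos, ← integral_sub (hint c) (hint c')]
  refine (integral_pos_iff_support_of_nonneg ?_ ((hint c).sub (hint c'))).2 ?_
  rotate_left
  · have hna := nullSingletonClass_gaussianReal (μ := 0) one_ne_zero
    refine lt_of_lt_of_le ?_ (measure_mono hsup)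
    rw [prob_compl_eq_one_sub (measurableSet_singleton _), measure_singleton]
    simp
  · intro x
    refine sub_nonneg.2 (inv_anti₀ (by positivity) ?_)
    rcases eq_or_ne x 0 with rfl | hx
    · simp
    · linarith [hlt x hx]

theorem tendsto_integral_inv_one_add_sq {X : ∀ N, Ω N → ℝ}
    (hX : TendstoInDistribution X atTop (id : ℝ → ℝ) μ (gaussianReal 0 1)) (c : ℝ) :
    Tendsto (fun N => ∫ A, (1 + (c * X N A) ^ 2)⁻¹ ∂μ N) atTop
      (𝓝 (∫ x, (1 + (c * x) ^ 2)⁻¹ ∂gaussianReal 0 1)) := by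
  have hcont : Continuous fun x : ℝ => (1 + (c * x) ^ 2)⁻¹ :=
    Continuous.inv₀ (by fun_prop) fun x => by positivity
  have h := ProbabilityMeasure.tendsto_iff_forall_integral_tendsto.1 hX.tendsto
    (BoundedContinuousFunction.ofNormedAddCommGroup (fun x : ℝ => (1 + (c * x) ^ 2)⁻¹) hcont 1
      fun x => by
        rw [Real.norm_of_nonneg (by positivity)]
        exact inv_le_one_of_one_le₀ (by nlinarith [sq_nonneg (c * x)]))
  simp only [ProbabilityMeasure.coe_mk, Measure.map_id,
    BoundedContinuousFunction.coe_ofNormedAddCommGroup] at h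
  refine h.congr fun N => ?_
  rw [integral_map (hX.forall_aemeasurable N) hcont.aestronglyMeasurable]

/-- If `T_N` and `r_N T_N` both converge in distribution to `N(0, 1)`, with `r_N ≥ 0`, then
`r_N → 1`. -/
theorem tendsto_one_of_tendstoInDistribution_mul {T X : ∀ N, Ω N → ℝ} {r : ℕ → ℝ}
    (hT : TendstoInDistribution T atTop (id : ℝ → ℝ) μ (gaussianReal 0 1))
    (hX : TendstoInDistribution X atTop (id : ℝ → ℝ) μ (gaussianReal 0 1))
    (hr : ∀ N, 0 ≤ r N) (hXT : ∀ᶠ N in atTop, ∀ A, X N A = r N * T N A) :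
    Tendsto r atTop (𝓝 1) := by
  have hXlim := tendsto_integral_inv_one_add_sq hX 1
  have hint : ∀ (c : ℝ) N, Integrable (fun A => (1 + (c * T N A) ^ 2)⁻¹) (μ N) := by
    intro c N
    have := hT.forall_aemeasurable N
    refine Integrable.of_bound (AEMeasurable.aestronglyMeasurable (by fun_prop)) 1
      (ae_of_all _ fun x => ?_)
    rw [Real.norm_of_nonneg (by positivity)]
    exact inv_le_one_of_one_le₀ (by nlinarith [sq_nonneg (c * T N x)])
  have hmono : ∀ N, ∀ c c' : ℝ, 0 ≤ c → c ≤ c' →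
      ∫ A, (1 + (c' * T N A) ^ 2)⁻¹ ∂μ N ≤ ∫ A, (1 + (c * T N A) ^ 2)⁻¹ ∂μ N := by
    intro N c c' hc hcc
    refine integral_mono (hint _ _) (hint _ _) fun A => inv_anti₀ (by positivity) ?_
    rw [mul_pow, mul_pow]
    gcongr
  have hXr : ∀ᶠ N in atTop, ∫ A, (1 + (1 * X N A) ^ 2)⁻¹ ∂μ N =
      ∫ A, (1 + (r N * T N A) ^ 2)⁻¹ ∂μ N := by
    filter_upwards [hXT] with N hN
    simp only [hN, one_mul]
  -- If `r N ≤ c < 1`, monotonicity puts the integral for `r N * T N` above the one for `c * T N`,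
  -- whose limit strictly exceeds the limit for scale `1`. The case `c > 1` is symmetric.
  refine tendsto_order.2 ⟨fun c hc => ?_, fun c hc => ?_⟩
  · rcases lt_or_ge c 0 with h0 | h0
    · exact Eventually.of_forall fun N => h0.trans_le (hr N)
    · have hlt := integral_inv_one_add_sq_strictAntiOn (Set.mem_Ici.2 h0)
        (Set.mem_Ici.2 zero_le_one) hc
      have hTlim := tendsto_integral_inv_one_add_sq hT c
      filter_upwards [hXr, hXlim.eventually_lt hTlim hlt] with N h1 h2
      by_contra hle
      have := hmono N (r N) c (hr N) (not_lt.1 hle)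
      linarith
  · have hlt := integral_inv_one_add_sq_strictAntiOn (Set.mem_Ici.2 zero_le_one)
        (Set.mem_Ici.2 (zero_le_one.trans hc.le)) hc
    have hTlim := tendsto_integral_inv_one_add_sq hT c
    filter_upwards [hXr, hTlim.eventually_lt hXlim hlt] with N h1 h2
    by_contra hle
    have := hmono N c (r N) (zero_le_one.trans hc.le) (not_lt.1 hle)
    linarith

end StandardNormalLimit

/-! ### Positive definite limits and inverse square roots. -/

namespace Matrix

variable {ι : Type*} [Fintype ι]

theorem abs_dotProduct_mulVec_le (M : Matrix ι ι ℝ) (v : ι → ℝ) :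
    |v ⬝ᵥ M *ᵥ v| ≤ (∑ i, ∑ j, |M i j|) * (v ⬝ᵥ v) := by
  have hv : ∀ i, v i * v i ≤ v ⬝ᵥ v := fun i =>
    Finset.single_le_sum (f := fun i => v i * v i) (fun j _ => mul_self_nonneg _)
      (Finset.mem_univ i)
  have hq : v ⬝ᵥ M *ᵥ v = ∑ i, ∑ j, M i j * (v i * v j) := by
    simp only [mulVec, dotProduct, Finset.mul_sum]
    refine Finset.sum_congr rfl fun i _ => Finset.sum_congr rfl fun j _ => ?_
    ring
  simp_rw [hq, Finset.sum_mul]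
  refine (Finset.abs_sum_le_sum_abs _ _).trans (Finset.sum_le_sum fun i _ => ?_)
  refine (Finset.abs_sum_le_sum_abs _ _).trans (Finset.sum_le_sum fun j _ => ?_)
  rw [abs_mul]
  refine mul_le_mul_of_nonneg_left ?_ (abs_nonneg _)
  rw [abs_le]
  constructor <;> nlinarith [hv i, hv j, sq_nonneg (v i + v j), sq_nonneg (v i - v j)]

theorem dotProduct_self_pos {v : ι → ℝ} (hv : v ≠ 0) : 0 < v ⬝ᵥ v := by
  simpa using (dotProduct_star_self_pos_iff (v := v)).2 hv

/-- The constant is the minimum of the quadratic form on the compact unit sphere; the sphere is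
empty only for an empty index type. -/
theorem PosDef.exists_forall_mul_le {M : Matrix ι ι ℝ} (hM : M.PosDef) :
    ∃ κ > 0, ∀ v : ι → ℝ, κ * (v ⬝ᵥ v) ≤ v ⬝ᵥ M *ᵥ v := by
  have hpos : ∀ v : ι → ℝ, v ≠ 0 → 0 < v ⬝ᵥ M *ᵥ v := fun v hv => by
    simpa using hM.dotProduct_mulVec_pos hv
  rcases Set.eq_empty_or_nonempty {v : ι → ℝ | v ⬝ᵥ v = 1} with hE | hE
  · refine ⟨1, one_pos, fun v => ?_⟩
    rcases eq_or_ne v 0 with rfl | hv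
    · simp
    · exfalso
      have h0 := dotProduct_self_pos hv
      refine Set.eq_empty_iff_forall_notMem.1 hE ((√(v ⬝ᵥ v))⁻¹ • v) ?_
      simp only [Set.mem_ofPred_eq, smul_dotProduct, dotProduct_smul, smul_eq_mul]
      rw [← mul_assoc, ← mul_inv, Real.mul_self_sqrt h0.le, inv_mul_cancel₀ h0.ne']
  · obtain ⟨u, hu, hmin⟩ := (isCompact_setOf_dotProduct_self_eq_one ι).exists_isMinOn hE
      (f := fun v => v ⬝ᵥ M *ᵥ v) (by fun_prop)
    refine ⟨u ⬝ᵥ M *ᵥ u, hpos u ?_, fun v => ?_⟩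
    · rintro rfl
      simp at hu
    · rcases eq_or_ne v 0 with rfl | hv
      · simp
      have h0 := dotProduct_self_pos hv
      have hmem : (√(v ⬝ᵥ v))⁻¹ • v ∈ {v : ι → ℝ | v ⬝ᵥ v = 1} := by
        simp only [Set.mem_ofPred_eq, smul_dotProduct, dotProduct_smul, smul_eq_mul]
        rw [← mul_assoc, ← mul_inv, Real.mul_self_sqrt h0.le, inv_mul_cancel₀ h0.ne']
      have h1 : u ⬝ᵥ M *ᵥ u ≤ _ := hmin hmem
      simp only [mulVec_smul, smul_dotProduct, dotProduct_smul, smul_eq_mul] at h1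
      rw [← mul_assoc, ← mul_inv, Real.mul_self_sqrt h0.le, inv_mul_eq_div, le_div_iff₀ h0] at h1
      exact h1

/-- Matrices that converge to a positive definite matrix are eventually uniformly positive. -/
theorem PosDef.exists_eventually_mul_le {M : Matrix ι ι ℝ} (hM : M.PosDef)
    {A : ℕ → Matrix ι ι ℝ} (hA : Tendsto A atTop (𝓝 M)) :
    ∃ κ > 0, ∀ᶠ N in atTop, ∀ v : ι → ℝ, κ * (v ⬝ᵥ v) ≤ v ⬝ᵥ A N *ᵥ v := by
  obtain ⟨κ, hκ, h⟩ := hM.exists_forall_mul_le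
  refine ⟨κ / 2, half_pos hκ, ?_⟩
  have hlim : Tendsto (fun N => ∑ i, ∑ j, |(A N - M) i j|) atTop (𝓝 0) := by
    have hc : Continuous fun B : Matrix ι ι ℝ => ∑ i, ∑ j, |(B - M) i j| := by fun_prop
    have := (hc.tendsto M).comp hA
    rw [show (∑ i, ∑ j, |(M - M) i j|) = 0 by simp] at this
    exact this
  filter_upwards [hlim.eventually_lt_const (half_pos hκ)] with N hN v
  have h0 : 0 ≤ v ⬝ᵥ v := by simpa using dotProduct_star_self_nonneg v
  have h1 := neg_le_of_abs_le (abs_dotProduct_mulVec_le (A N - M) v)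
  rw [sub_mulVec, dotProduct_sub] at h1
  have h2 := h v
  have h3 := mul_le_mul_of_nonneg_right hN.le h0
  linarith

variable [DecidableEq ι]

theorem transpose_invSqrt (M : Matrix ι ι ℝ) : M.invSqrtᵀ = M.invSqrt := by
  have h : IsSelfAdjoint M.invSqrt := cfc_predicate _ _
  rw [IsSelfAdjoint, star_eq_conjTranspose, conjTranspose_eq_transpose_of_trivial] at h
  exact h

/-- The spectrum is finite, so every function is continuous on it, and positive, so `(√t)⁻¹ (√t)⁻¹ t
= 1` there. -/
theorem PosDef.invSqrt_mul_invSqrt_mul {M : Matrix ι ι ℝ} (hM : M.PosDef) :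
    M.invSqrt * M.invSqrt * M = 1 := by
  have hsa : IsSelfAdjoint M := hM.isHermitian
  have hfin : (spectrum ℝ M).Finite := Matrix.finite_real_spectrum
  have hc : ∀ f : ℝ → ℝ, ContinuousOn f (spectrum ℝ M) := fun f => hfin.continuousOn f
  have hpos : ∀ t ∈ spectrum ℝ M, 0 < t := by
    intro t ht
    rw [hM.isHermitian.spectrum_real_eq_range_eigenvalues] at ht
    obtain ⟨i, rfl⟩ := ht
    exact hM.eigenvalues_pos i
  set f : ℝ → ℝ := fun t => (√t)⁻¹ with hf
  calc M.invSqrt * M.invSqrt * M = cfc f M * cfc f M * cfc (fun t : ℝ => t) M := by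
        rw [cfc_id' ℝ M]; rfl
    _ = cfc (fun t => f t * f t * t) M := by
        rw [cfc_mul _ _ M (hc _) (hc _), cfc_mul _ _ M (hc _) (hc _)]
    _ = cfc (fun _ => (1 : ℝ)) M := by
        refine cfc_congr fun t ht => ?_
        have h := hpos t ht
        simp only [hf]
        rw [← mul_inv, Real.mul_self_sqrt h.le, inv_mul_cancel₀ h.ne']
    _ = 1 := cfc_const_one ℝ M

end Matrix

/-! ### Normal limits for linear combinations of Horvitz–Thompson errors. -/

namespace SamplingDesign

section

variable {N : ℕ} {D : SamplingDesign N} {ι : Type*} [Fintype ι]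

theorem htError_dotProduct (w : Fin N → ι → ℝ) (A : Finset (Fin N)) (v : ι → ℝ) :
    v ⬝ᵥ D.htError w A = ∑ i, D.dev i A * (v ⬝ᵥ w i) := by
  simp only [htError, dotProduct_sum, dotProduct_smul, smul_eq_mul, dev]

theorem dotProduct_htCov_mulVec (w : Fin N → ι → ℝ) (v : ι → ℝ) :
    v ⬝ᵥ D.htCov w *ᵥ v =
      ∑ i, ∑ j, D.Δ i j / (D.incl i * D.incl j) * ((v ⬝ᵥ w i) * (v ⬝ᵥ w j)) := by
  simp only [htCov, sum_mulVec, dotProduct_sum, smul_mulVec, dotProduct_smul, smul_eq_mul,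
    vecMulVec_mulVec]
  refine Finset.sum_congr rfl fun i _ => Finset.sum_congr rfl fun j _ => ?_
  simp only [op_smul_eq_smul, smul_eq_mul]
  rw [dotProduct_comm (w j)]
  ring

omit [Fintype ι] in
theorem htCov_isHermitian (w : Fin N → ι → ℝ) : (D.htCov w).IsHermitian := by
  ext a b
  simp only [conjTranspose_apply, star_trivial, htCov, Matrix.sum_apply, Matrix.smul_apply,
    vecMulVec_apply, smul_eq_mul]
  rw [Finset.sum_comm]
  refine Finset.sum_congr rfl fun i _ => Finset.sum_congr rfl fun j _ => ?_
  rw [Δ_comm]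
  ring

theorem integral_htError_sq (hD : ∀ i, 0 < D.incl i) (w : Fin N → ι → ℝ) (v : ι → ℝ) :
    ∫ A, (v ⬝ᵥ D.htError w A) ^ 2 ∂D.law = v ⬝ᵥ D.htCov w *ᵥ v := by
  have h := integral_norm_sum_dev_sq hD fun i => v ⬝ᵥ w i
  simp only [smul_eq_mul, Real.norm_eq_abs, sq_abs] at h
  simp_rw [htError_dotProduct, h, dotProduct_htCov_mulVec]
  refine Finset.sum_congr rfl fun i _ => Finset.sum_congr rfl fun j _ => ?_
  simp only [RCLike.inner_apply, conj_trivial]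
  ring

end

variable {D : (N : ℕ) → SamplingDesign N} {ι : Type*} [Fintype ι]
  {w : (N : ℕ) → Fin N → ι → ℝ}

theorem size_nonneg {N : ℕ} (D : SamplingDesign N) : 0 ≤ D.size := by
  rw [size_eq]
  exact Finset.sum_nonneg fun i _ => D.incl_nonneg i

theorem posDef_htCov_of_mul_le {N : ℕ} {D : SamplingDesign N} {w : Fin N → ι → ℝ} {κ c : ℝ}
    (hκ : 0 < κ) (hc : 0 ≤ c)
    (h : ∀ v : ι → ℝ, κ * (v ⬝ᵥ v) ≤ v ⬝ᵥ (c • D.htCov w) *ᵥ v) :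
    (D.htCov w).PosDef := by
  refine PosDef.of_dotProduct_mulVec_pos (htCov_isHermitian w) fun v hv => ?_
  have h0 := Matrix.dotProduct_self_pos hv
  have h1 := h v
  rw [smul_mulVec, dotProduct_smul, smul_eq_mul] at h1
  rw [star_trivial]
  by_contra hle
  have := mul_nonpos_of_nonneg_of_nonpos hc (not_lt.1 hle)
  have := mul_pos hκ h0
  linarith

/-- Asymptotic normality of linear combinations, with varying coefficients, of Horvitz–Thompson
errors. -/
theorem tendstoInDistribution_dotProduct_htError [DecidableEq ι]
    (hD : ∀ N i, 0 < (D N).incl i) (hW : HTAsymptoticallyNormal D w)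
    (hw : BoundedFourthMoment w) {M : Matrix ι ι ℝ} (hM : M.PosDef)
    (hlim : Tendsto (fun N : ℕ => ((D N).size / (N : ℝ) ^ 2) • (D N).htCov (w N)) atTop (𝓝 M))
    {c : ℕ → ι → ℝ} (hc : ∀ N, c N ≠ 0) :
    TendstoInDistribution
      (fun N (A : Finset (Fin N)) =>
        (c N ⬝ᵥ (D N).htError (w N) A) / √(c N ⬝ᵥ (D N).htCov (w N) *ᵥ c N))
      atTop (id : ℝ → ℝ) (fun N => (D N).law) (gaussianReal 0 1) := by
  have hZ := hW hw ⟨M, hM, hlim⟩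
  obtain ⟨κ, hκ, hpos⟩ := hM.exists_eventually_mul_le hlim
  have hPD : ∀ᶠ N in atTop, ((D N).htCov (w N)).PosDef := hpos.mono fun N hN =>
    posDef_htCov_of_mul_le hκ (div_nonneg (size_nonneg _) (sq_nonneg _)) hN
  set B : ℕ → Matrix ι ι ℝ := fun N => ((D N).htCov (w N)).invSqrt with hB
  have hBt : ∀ N, (B N)ᵀ = B N := fun N => transpose_invSqrt _
  have hadj : ∀ N (v u : ι → ℝ), v ⬝ᵥ B N *ᵥ u = (B N *ᵥ v) ⬝ᵥ u := by
    intro N v u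
    rw [dotProduct_mulVec, ← mulVec_transpose, hBt]
  -- With `W` the covariance matrix and `B = W^(-1/2)`, the vector `B W c` is `W^(1/2) c`. Thus `a
  -- N` is a unit vector, and its product with the standardized error is the standardized
  -- combination.
  set a : ℕ → ι → ℝ := fun N => (√(c N ⬝ᵥ (D N).htCov (w N) *ᵥ c N))⁻¹ •
    B N *ᵥ (D N).htCov (w N) *ᵥ c N with ha
  have hBB : ∀ᶠ N in atTop, ∀ v : ι → ℝ, B N *ᵥ B N *ᵥ (D N).htCov (w N) *ᵥ v = v :=
    hPD.mono fun N hN v => by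
      rw [mulVec_mulVec, mulVec_mulVec, hN.invSqrt_mul_invSqrt_mul, one_mulVec]
  have hBB' : ∀ᶠ N in atTop, ∀ v : ι → ℝ, B N *ᵥ (D N).htCov (w N) *ᵥ B N *ᵥ v = v :=
    hPD.mono fun N hN v => by
      have h1 : B N * (D N).htCov (w N) * B N = 1 := by
        have := hN.invSqrt_mul_invSqrt_mul
        rw [mul_assoc] at this
        exact mul_eq_one_comm.1 this
      rw [mulVec_mulVec, mulVec_mulVec, h1, one_mulVec]
  have hmain := tendstoInDistribution_dotProduct (a := a) hZ
    (Eventually.of_forall fun N v => MemLp.of_discrete)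
    (hBB'.mono fun N hN v => by
      have h1 : ∀ A, v ⬝ᵥ ((D N).htCov (w N)).invSqrt *ᵥ (D N).htError (w N) A =
        (B N *ᵥ v) ⬝ᵥ (D N).htError (w N) A := fun A => hadj N v _
      simp_rw [h1]
      rw [integral_htError_sq (hD N), ← hadj, hN])
    (by
      filter_upwards [hPD, hBB] with N hN hN'
      have h0 : 0 < c N ⬝ᵥ (D N).htCov (w N) *ᵥ c N := by
        simpa using hN.dotProduct_mulVec_pos (hc N)
      simp only [ha, smul_dotProduct, dotProduct_smul, smul_eq_mul]
      rw [← hadj, hN', dotProduct_comm _ (c N), ← mul_assoc, ← mul_inv, Real.mul_self_sqrt h0.le,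
        inv_mul_cancel₀ h0.ne'])
  -- The two sequences coincide only once `W` is positive definite, that is, for large `N`;
  -- Slutsky's theorem with empty exceptional sets covers this.
  refine tendstoInDistribution_gaussianReal_of_sub hmain
    (fun N => Measurable.of_discrete.aemeasurable) fun ε hε => ?_
  refine tendsto_const_nhds.congr' ?_
  filter_upwards [hBB] with N hN
  have hempty : {A : Finset (Fin N) | ε ≤ |a N ⬝ᵥ (B N *ᵥ (D N).htError (w N) A) -
      (c N ⬝ᵥ (D N).htError (w N) A) / √(c N ⬝ᵥ (D N).htCov (w N) *ᵥ c N)|} = ∅ := by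
    refine Set.eq_empty_of_forall_notMem fun A hA => ?_
    simp only [Set.mem_ofPred_eq, ha, hadj, mulVec_smul, smul_dotProduct, hN, smul_eq_mul] at hA
    rw [inv_mul_eq_div, sub_self, abs_zero] at hA
    exact absurd hA (not_le.2 hε)
  rw [hempty, measureReal_empty]

end SamplingDesign

/-! ### Deterministic analysis of a single sample. -/

namespace EntropyCalibration

variable {p : ℕ} {S : EntropyCalibration p}

/-- The covariates `z_i` as vectors of a Euclidean space. -/
def zVec (S : EntropyCalibration p) (N : ℕ) (i : Fin N) : EuclideanSpace ℝ (Fin p ⊕ Unit) :=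
  WithLp.toLp 2 (S.z N i)

/-- The coefficient vector `γ_N` as a vector of a Euclidean space. -/
def γVec (S : EntropyCalibration p) (N : ℕ) : EuclideanSpace ℝ (Fin p ⊕ Unit) :=
  WithLp.toLp 2 (S.γ N)

theorem inner_toLp_zVec (l : EuclideanSpace ℝ (Fin p ⊕ Unit)) (N : ℕ) (i : Fin N) :
    inner ℝ l (S.zVec N i) = l.ofLp ⬝ᵥ S.z N i := by
  rw [EuclideanSpace.inner_eq_star_dotProduct, star_trivial, dotProduct_comm]
  rfl

theorem lam₀_dotProduct (N : ℕ) (i : Fin N) : lam₀ ⬝ᵥ S.z N i = S.g (S.d N i) := by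
  simp [lam₀, z, dotProduct]

theorem norm_toLp_sq {ι : Type*} [Fintype ι] (v : ι → ℝ) :
    ‖(WithLp.toLp 2 v : EuclideanSpace ℝ ι)‖ ^ 2 = v ⬝ᵥ v := by
  rw [EuclideanSpace.norm_sq_eq]
  simp [dotProduct, sq]

theorem residual_eq (N : ℕ) (i : Fin N) :
    S.residual N i = S.y N i - inner ℝ (S.γVec N) (S.zVec N i) := by
  rw [residual, inner_toLp_zVec, dotProduct_comm]
  rfl

theorem sum_yz_sq (N : ℕ) (i : Fin N) :
    ∑ j, S.yz N i j ^ 2 = S.y N i ^ 2 + ‖S.zVec N i‖ ^ 2 := by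
  rw [zVec, norm_toLp_sq, Fintype.sum_sum_type]
  simp [yz, dotProduct, sq]

theorem BoundedWeights.exists_Icc (h : S.BoundedWeights) :
    ∃ c₁ ∈ S.V, ∃ c₂ ∈ S.V, 0 < c₁ ∧ c₁ < c₂ ∧ ∀ N i, S.d N i ∈ Set.Icc c₁ c₂ := by
  obtain ⟨c₁, h₁, c₂, h₂, hc₁, hc₂, hd⟩ := h
  -- The population of size one has a unit, whose weight separates `c₁` from `c₂`.
  have := hd 1 0
  exact ⟨c₁, h₁, c₂, h₂, hc₁, this.1.trans this.2, fun N i => ⟨(hd N i).1.le, (hd N i).2.le⟩⟩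

theorem BoundedWeights.nontrivial (h : S.BoundedWeights) : S.V.Nontrivial := by
  obtain ⟨c₁, h₁, c₂, h₂, -, h, -⟩ := h.exists_Icc
  exact ⟨c₁, h₁, c₂, h₂, h.ne⟩

theorem BoundedWeights.d_pos (h : S.BoundedWeights) (N : ℕ) (i : Fin N) : 0 < S.d N i := by
  obtain ⟨c₁, -, c₂, -, h0, -, hd⟩ := h.exists_Icc
  exact h0.trans_le (hd N i).1

theorem BoundedWeights.π_pos (h : S.BoundedWeights) (N : ℕ) (i : Fin N) : 0 < S.π N i :=
  inv_pos.1 (h.d_pos N i)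

theorem BoundedWeights.d_mem (hS : S.RegularEntropy) (h : S.BoundedWeights) (N : ℕ) (i : Fin N) :
    S.d N i ∈ S.V := by
  obtain ⟨c₁, h₁, c₂, h₂, -, -, hd⟩ := h.exists_Icc
  exact hS.interval.out h₁ h₂ (hd N i)

/-- First-order expansion of the weights `g⁻¹(⟨λ, z_i⟩)` around `λ₀`. -/
theorem abs_gInv_inner_sub_le {N : ℕ} {r η ε : ℝ} (hε : 0 ≤ ε)
    {l l₀ : EuclideanSpace ℝ (Fin p ⊕ Unit)} (hl : ‖l - l₀‖ ≤ r) {i : Fin N}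
    (hl₀z : inner ℝ l₀ (S.zVec N i) = S.g (S.d N i))
    (hT : inner ℝ l (S.zVec N i) ∈ S.g '' S.V)
    (hexp : ∀ s, |s| ≤ η → S.g (S.d N i) + s ∈ S.g '' S.V →
      |S.gInv (S.g (S.d N i) + s) - S.d N i - s / S.g' (S.d N i)| ≤ ε * |s|)
    (hrη : r * ‖S.zVec N i‖ ≤ η) :
    |S.gInv (inner ℝ l (S.zVec N i)) - S.d N i -
      inner ℝ (l - l₀) (S.zVec N i) / S.g' (S.d N i)| ≤
        ε * |inner ℝ (l - l₀) (S.zVec N i)| ∧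
    |S.gInv (inner ℝ l (S.zVec N i)) - S.d N i -
      inner ℝ (l - l₀) (S.zVec N i) / S.g' (S.d N i)| ≤
        ‖l - l₀‖ * (ε * ‖S.zVec N i‖) := by
  have h1 : inner ℝ l (S.zVec N i) = S.g (S.d N i) + inner ℝ (l - l₀) (S.zVec N i) := by
    rw [inner_sub_left, hl₀z]; ring
  have h3 : |S.gInv (inner ℝ l (S.zVec N i)) - S.d N i -
      inner ℝ (l - l₀) (S.zVec N i) / S.g' (S.d N i)| ≤
        ε * |inner ℝ (l - l₀) (S.zVec N i)| := by
    rw [h1] at hT ⊢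
    refine hexp _ ?_ hT
    refine (abs_real_inner_le_norm _ _).trans (le_trans ?_ hrη)
    gcongr
  refine ⟨h3, h3.trans ?_⟩
  calc _ ≤ ε * (‖l - l₀‖ * ‖S.zVec N i‖) := by
        gcongr
        exact abs_real_inner_le_norm _ _
    _ = _ := by ring

/-- Existence of a solution of the calibration equations for one sample. -/
theorem exists_multiplier_of_norm_lt (hS : S.RegularEntropy) (hW : S.BoundedWeights)
    {N : ℕ} {A : Finset (Fin N)} {r η ε m κ : ℝ} (hr : 0 < r) (hm : 0 < m) (hκ : 0 < κ)
    (hε : 0 ≤ ε) {l₀ : EuclideanSpace ℝ (Fin p ⊕ Unit)}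
    (hl₀z : ∀ i, inner ℝ l₀ (S.zVec N i) = S.g (S.d N i))
    (hT : ∀ l ∈ Metric.closedBall l₀ r, ∀ i, inner ℝ l (S.zVec N i) ∈ S.g '' S.V)
    (hexp : ∀ i, ∀ s, |s| ≤ η → S.g (S.d N i) + s ∈ S.g '' S.V →
      |S.gInv (S.g (S.d N i) + s) - S.d N i - s / S.g' (S.d N i)| ≤ ε * |s|)
    (hrη : ∀ i, r * ‖S.zVec N i‖ ≤ η)
    (hmε : ∀ i, m + ε ≤ (S.g' (S.d N i))⁻¹)
    (hlow : ∀ v : EuclideanSpace ℝ (Fin p ⊕ Unit),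
      κ * ‖v‖ ^ 2 ≤ ∑ i ∈ A, inner ℝ v (S.zVec N i) ^ 2)
    (hsmall : ‖∑ i, (S.design N).dev i A • S.zVec N i‖ < m * κ * r) :
    ∃ l ∈ Metric.closedBall l₀ r,
      m * κ * ‖l - l₀‖ ≤ ‖∑ i, (S.design N).dev i A • S.zVec N i‖ ∧
      ∑ i ∈ A, S.gInv (inner ℝ l (S.zVec N i)) • S.zVec N i = ∑ i, S.zVec N i := by
  have hV := hW.nontrivial
  have hd : ∀ i, S.gInv (S.g (S.d N i)) = S.d N i := fun i => hS.gInv_g hV (hW.d_mem hS N i)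
  -- At `λ₀` the weights are `d_i`, so the gradient of the dual objective is minus the
  -- Horvitz–Thompson error of `z`.
  have hHT : ∑ i ∈ A, S.gInv (inner ℝ l₀ (S.zVec N i)) • S.zVec N i - ∑ i, S.zVec N i =
      -∑ i, (S.design N).dev i A • S.zVec N i := by
    simp_rw [hl₀z, hd]
    have := SamplingDesign.sum_smul_eq_sub_sum_dev (D := S.design N) (S.zVec N) A
    simp only [d, SamplingDesign.weight]
    rw [this]
    abel
  have hmono : ∀ l ∈ Metric.closedBall l₀ r, m * κ * ‖l - l₀‖ ^ 2 ≤
      ∑ i ∈ A, (S.gInv (inner ℝ l (S.zVec N i)) - S.gInv (inner ℝ l₀ (S.zVec N i))) *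
        inner ℝ (l - l₀) (S.zVec N i) := by
    intro l hl
    calc m * κ * ‖l - l₀‖ ^ 2 = m * (κ * ‖l - l₀‖ ^ 2) := by ring
      _ ≤ m * ∑ i ∈ A, inner ℝ (l - l₀) (S.zVec N i) ^ 2 := by
          gcongr; exact hlow _
      _ = ∑ i ∈ A, m * inner ℝ (l - l₀) (S.zVec N i) ^ 2 := Finset.mul_sum _ _ _
      _ ≤ _ := by
          refine Finset.sum_le_sum fun i _ => ?_
          rw [hl₀z, hd]
          -- With `s` the increment of the argument, the weight changes by `s / g'(d_i)` up to `ε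
          -- |s|`. As `1 / g'(d_i) ≥ m + ε`, its product with `s` is at least `m s²`.
          have h1 := (abs_gInv_inner_sub_le hε (mem_closedBall_iff_norm.1 hl) (hl₀z i)
            (hT l hl i) (hexp i) (hrη i)).1
          generalize inner ℝ (l - l₀) (S.zVec N i) = s at h1 ⊢
          generalize S.gInv (inner ℝ l (S.zVec N i)) - S.d N i = q at h1 ⊢
          have h2 := hmε i
          rw [div_eq_mul_inv] at h1
          generalize (S.g' (S.d N i))⁻¹ = k at h1 h2 ⊢
          have h3 : |(q - s * k) * s| ≤ ε * s ^ 2 := by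
            rw [abs_mul, ← sq_abs s, sq, ← mul_assoc]
            gcongr
          have h4 := neg_le_of_abs_le h3
          have h5 := mul_le_mul_of_nonneg_right h2 (sq_nonneg s)
          linarith
  have := exists_multiplier (s := A) (z := S.zVec N)
    (b := ∑ i, S.zVec N i) (l₀ := l₀) (h := S.gInv) (F := S.F) (T := S.g '' S.V)
    (hS.continuousOn_gInv hV) (hS.continuousOn_F hV)
    (fun u hu t ht => hS.gInv_mul_sub_le hu ht) hr (mul_pos hm hκ)
    (fun l hl i _ => hT l hl i) hmono (by rw [hHT, norm_neg]; exact hsmall)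
  rwa [hHT, norm_neg] at this

/-- Calibration gives the fitted part `z_iᵀ γ_N` its exact population total, so only the residuals
remain in the difference. -/
theorem estimator_sub_greg {N : ℕ} {A : Finset (Fin N)} {ω : Fin N → ℝ}
    (h : ∑ i ∈ A, ω i • S.z N i = ∑ i, S.z N i) :
    S.estimator N A (fun i => ω i) - S.greg N A =
      ∑ i ∈ A, (ω i - S.d N i) * S.residual N i := by
  have hest : S.estimator N A (fun i => ω i) = ∑ i ∈ A, ω i * S.y N i := by
    rw [estimator, ← Finset.sum_coe_sort A]
  have hzγ : ∑ i ∈ A, ω i * (S.z N i ⬝ᵥ S.γ N) = ∑ i, S.z N i ⬝ᵥ S.γ N := by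
    rw [← sum_dotProduct, ← h, sum_dotProduct]
    simp_rw [smul_dotProduct, smul_eq_mul]
  rw [hest, greg, ← hzγ, ← sub_sub, ← Finset.sum_sub_distrib, ← Finset.sum_sub_distrib]
  refine Finset.sum_congr rfl fun i _ => ?_
  rw [residual]
  simp only [d, π, SamplingDesign.weight]
  ring

/-- Existence of the calibration weights for one sample, and distance between the calibration
estimator and the regression estimator. -/
theorem exists_isCalibrated_and_abs_sub_greg_le (hS : S.RegularEntropy) (hW : S.BoundedWeights)
    {N : ℕ} {A : Finset (Fin N)} {r η ε m κ : ℝ} (hr : 0 < r) (hm : 0 < m) (hκ : 0 < κ)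
    (hε : 0 ≤ ε)
    (hball : ∀ l ∈ Metric.closedBall (WithLp.toLp 2 lam₀ : EuclideanSpace ℝ (Fin p ⊕ Unit)) r,
      ∀ i, l.ofLp ⬝ᵥ S.z N i ∈ S.g '' S.V)
    (hexp : ∀ i, ∀ s, |s| ≤ η → S.g (S.d N i) + s ∈ S.g '' S.V →
      |S.gInv (S.g (S.d N i) + s) - S.d N i - s / S.g' (S.d N i)| ≤ ε * |s|)
    (hrη : ∀ i, r * ‖S.zVec N i‖ ≤ η)
    (hmε : ∀ i, m + ε ≤ (S.g' (S.d N i))⁻¹)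
    (hlow : ∀ v : EuclideanSpace ℝ (Fin p ⊕ Unit),
      κ * ‖v‖ ^ 2 ≤ ∑ i ∈ A, inner ℝ v (S.zVec N i) ^ 2)
    (hsmall : ‖∑ i, (S.design N).dev i A • S.zVec N i‖ < m * κ * r) :
    ∃ ω : A → ℝ, S.IsCalibrated N A ω ∧
      m * κ * |S.estimator N A ω - S.greg N A| ≤
        ‖∑ i, (S.design N).dev i A • S.zVec N i‖ *
          (‖∑ i ∈ A, (S.residual N i / S.g' (S.d N i)) • S.zVec N i‖ +
            ε * ∑ i, ‖S.zVec N i‖ * |S.residual N i|) := by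
  set l₀ : EuclideanSpace ℝ (Fin p ⊕ Unit) := WithLp.toLp 2 lam₀ with hl₀
  have hT : ∀ l ∈ Metric.closedBall l₀ r, ∀ i, inner ℝ l (S.zVec N i) ∈ S.g '' S.V := by
    intro l hl i
    rw [inner_toLp_zVec]
    exact hball l hl i
  have hl₀z : ∀ i, inner ℝ l₀ (S.zVec N i) = S.g (S.d N i) := fun i => by
    rw [inner_toLp_zVec, hl₀, lam₀_dotProduct]
  obtain ⟨l, hl, hnorm, hcal⟩ := exists_multiplier_of_norm_lt hS hW hr hm hκ hε hl₀z hT hexp hrη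
    hmε hlow hsmall
  have hcal' : ∑ i ∈ A, S.gInv (l.ofLp ⬝ᵥ S.z N i) • S.z N i = ∑ i, S.z N i := by
    simp_rw [inner_toLp_zVec] at hcal
    have := congrArg (WithLp.ofLp (p := 2)) hcal
    simpa only [zVec, WithLp.ofLp_sum, WithLp.ofLp_smul] using this
  refine ⟨fun i => S.gInv (l.ofLp ⬝ᵥ S.z N i),
    hS.isCalibrated_of_multiplier (fun i _ => hball l hl i) hcal', ?_⟩
  rw [estimator_sub_greg (ω := fun i => S.gInv (l.ofLp ⬝ᵥ S.z N i)) hcal']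
  simp_rw [← inner_toLp_zVec]
  have hsplit : ∑ i ∈ A, (S.gInv (inner ℝ l (S.zVec N i)) - S.d N i) * S.residual N i =
      inner ℝ (l - l₀) (∑ i ∈ A, (S.residual N i / S.g' (S.d N i)) • S.zVec N i) +
      ∑ i ∈ A, (S.gInv (inner ℝ l (S.zVec N i)) - S.d N i -
        inner ℝ (l - l₀) (S.zVec N i) / S.g' (S.d N i)) * S.residual N i := by
    rw [inner_sum, ← Finset.sum_add_distrib]
    refine Finset.sum_congr rfl fun i _ => ?_
    rw [real_inner_smul_right]
    ring
  have hrem : |∑ i ∈ A, (S.gInv (inner ℝ l (S.zVec N i)) - S.d N i -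
        inner ℝ (l - l₀) (S.zVec N i) / S.g' (S.d N i)) * S.residual N i| ≤
      ‖l - l₀‖ * (ε * ∑ i, ‖S.zVec N i‖ * |S.residual N i|) := by
    refine (Finset.abs_sum_le_sum_abs _ _).trans ?_
    rw [Finset.mul_sum, Finset.mul_sum]
    refine (Finset.sum_le_sum fun i _ => ?_).trans
      (Finset.sum_le_sum_of_subset_of_nonneg (Finset.subset_univ A) fun i _ _ => by positivity)
    rw [abs_mul, ← mul_assoc, ← mul_assoc, mul_assoc ‖l - l₀‖]
    exact mul_le_mul_of_nonneg_right (abs_gInv_inner_sub_le hε (mem_closedBall_iff_norm.1 hl)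
      (hl₀z i) (hT l hl i) (hexp i) (hrη i)).2 (abs_nonneg _)
  have hnn : 0 ≤ ∑ i, ‖S.zVec N i‖ * |S.residual N i| :=
    Finset.sum_nonneg fun i _ => by positivity
  rw [hsplit]
  calc _ ≤ m * κ * (‖l - l₀‖ * ‖∑ i ∈ A, (S.residual N i / S.g' (S.d N i)) • S.zVec N i‖ +
        ‖l - l₀‖ * (ε * ∑ i, ‖S.zVec N i‖ * |S.residual N i|)) :=
        mul_le_mul_of_nonneg_left ((abs_add_le _ _).trans
          (add_le_add (abs_real_inner_le_norm _ _) hrem)) (mul_pos hm hκ).le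
    _ = m * κ * ‖l - l₀‖ * (‖∑ i ∈ A, (S.residual N i / S.g' (S.d N i)) • S.zVec N i‖ +
        ε * ∑ i, ‖S.zVec N i‖ * |S.residual N i|) := by ring
    _ ≤ _ := mul_le_mul_of_nonneg_right hnorm (add_nonneg (norm_nonneg _) (mul_nonneg hε hnn))

end EntropyCalibration

/-! ### Moment bounds and events of high probability. -/

namespace EntropyCalibration

variable {p : ℕ} {S : EntropyCalibration p}

/-- `‖(y_i, z_iᵀ)‖²`. -/
def sqNorm (S : EntropyCalibration p) (N : ℕ) (i : Fin N) : ℝ :=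
  S.y N i ^ 2 + ‖S.zVec N i‖ ^ 2

theorem sqNorm_nonneg (N : ℕ) (i : Fin N) : 0 ≤ S.sqNorm N i := by
  unfold sqNorm; positivity

theorem norm_zVec_sq_le (N : ℕ) (i : Fin N) : ‖S.zVec N i‖ ^ 2 ≤ S.sqNorm N i := by
  unfold sqNorm; nlinarith [sq_nonneg (S.y N i)]

theorem exists_inv_g'_bounds (hS : S.RegularEntropy) (hW : S.BoundedWeights) :
    ∃ m > 0, ∃ M > 0, ∀ N i, m ≤ (S.g' (S.d N i))⁻¹ ∧ (S.g' (S.d N i))⁻¹ ≤ M := by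
  obtain ⟨c₁, h₁, c₂, h₂, -, hlt, hd⟩ := hW.exists_Icc
  have hsub : Set.Icc c₁ c₂ ⊆ S.V := hS.interval.out h₁ h₂
  have hcont : ContinuousOn (fun v => (S.g' v)⁻¹) (Set.Icc c₁ c₂) :=
    ((hS.continuousOn_g' hW.nontrivial).mono hsub).inv₀ fun v hv => (hS.deriv_pos v (hsub hv)).ne'
  have hne : (Set.Icc c₁ c₂).Nonempty := Set.nonempty_Icc.2 hlt.le
  obtain ⟨a, ha, hmin⟩ := isCompact_Icc.exists_isMinOn hne hcont
  obtain ⟨b, hb, hmax⟩ := isCompact_Icc.exists_isMaxOn hne hcont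
  exact ⟨_, inv_pos.2 (hS.deriv_pos a (hsub ha)), _, inv_pos.2 (hS.deriv_pos b (hsub hb)),
    fun N i => ⟨hmin (hd N i), hmax (hd N i)⟩⟩

theorem exists_abs_g_le (hS : S.RegularEntropy) (hW : S.BoundedWeights) :
    ∃ C, ∀ N i, |S.g (S.d N i)| ≤ C := by
  obtain ⟨c₁, h₁, c₂, h₂, -, hlt, hd⟩ := hW.exists_Icc
  have hsub : Set.Icc c₁ c₂ ⊆ S.V := hS.interval.out h₁ h₂
  obtain ⟨C, hC⟩ := isCompact_Icc.exists_bound_of_continuousOn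
    ((hS.continuousOn_g hW.nontrivial).mono hsub)
  exact ⟨C, fun N i => hC _ (hd N i)⟩

/-- The extra coordinate `g(d_i)` is bounded, since the weights stay in a compact subinterval of
`V`; the moment bound for `(y, x)` therefore extends to `(y, z)`. -/
theorem exists_sum_sqNorm_sq_le (hS : S.RegularEntropy) (hW : S.BoundedWeights)
    (hM : S.MomentConditions) :
    ∃ C > 0, ∀ᶠ N : ℕ in atTop, ∑ i, S.sqNorm N i ^ 2 ≤ C * N := by
  obtain ⟨G, hG⟩ := exists_abs_g_le hS hW
  obtain ⟨C, hC⟩ := hM.fourth_moment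
  refine ⟨2 * |C| + 2 * G ^ 4 + 1, by positivity, ?_⟩
  filter_upwards [hC, eventually_gt_atTop 0] with N hN hpos
  have hN0 : (0 : ℝ) < N := by exact_mod_cast hpos
  rw [inv_mul_le_iff₀ hN0] at hN
  have h1 : ∀ i, S.sqNorm N i = ∑ j, S.yx N i j ^ 2 + S.g (S.d N i) ^ 2 := by
    intro i
    rw [sqNorm, zVec, norm_toLp_sq, Fintype.sum_sum_type]
    simp [yx, z, dotProduct, sq, add_assoc]
  have h2 : ∀ i, S.sqNorm N i ^ 2 ≤ 2 * (∑ j, S.yx N i j ^ 2) ^ 2 + 2 * G ^ 4 := by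
    intro i
    rw [h1]
    have h3 : S.g (S.d N i) ^ 2 ≤ G ^ 2 := by
      rw [← sq_abs]
      exact pow_le_pow_left₀ (abs_nonneg _) (hG N i) 2
    have h4 : (S.g (S.d N i) ^ 2) ^ 2 ≤ (G ^ 2) ^ 2 := pow_le_pow_left₀ (sq_nonneg _) h3 2
    nlinarith [sq_nonneg ((∑ j, S.yx N i j ^ 2) - S.g (S.d N i) ^ 2)]
  calc ∑ i, S.sqNorm N i ^ 2 ≤ ∑ i, (2 * (∑ j, S.yx N i j ^ 2) ^ 2 + 2 * G ^ 4) :=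
        Finset.sum_le_sum fun i _ => h2 i
    _ = 2 * ∑ i, (∑ j, S.yx N i j ^ 2) ^ 2 + N * (2 * G ^ 4) := by
        rw [Finset.sum_add_distrib, ← Finset.mul_sum, Finset.sum_const, Finset.card_univ,
          Fintype.card_fin, nsmul_eq_mul]
    _ ≤ _ := by nlinarith [mul_le_mul_of_nonneg_left (le_abs_self C) hN0.le]

theorem boundedFourthMoment_yz (hS : S.RegularEntropy) (hW : S.BoundedWeights)
    (hM : S.MomentConditions) : BoundedFourthMoment S.yz := by
  obtain ⟨C, hC, h⟩ := exists_sum_sqNorm_sq_le hS hW hM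
  refine ⟨C, ?_⟩
  filter_upwards [h, eventually_gt_atTop 0] with N hN hpos
  have hN0 : (0 : ℝ) < N := by exact_mod_cast hpos
  rw [inv_mul_le_iff₀ hN0, mul_comm]
  simpa only [sum_yz_sq, sqNorm] using hN

theorem sum_sqNorm_le {N : ℕ} {C : ℝ} (h : ∑ i, S.sqNorm N i ^ 2 ≤ C * N) :
    ∑ i, S.sqNorm N i ≤ (C + 1) * N := by
  calc ∑ i, S.sqNorm N i ≤ ∑ i, (S.sqNorm N i ^ 2 + 1) :=
        Finset.sum_le_sum fun i _ => by nlinarith [sq_nonneg (S.sqNorm N i - 1)]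
    _ = ∑ i, S.sqNorm N i ^ 2 + N := by simp [Finset.sum_add_distrib]
    _ ≤ _ := by linarith

/-- Chebyshev's inequality for Horvitz–Thompson errors. -/
theorem exists_measureReal_norm_sum_dev_ge_le (hW : S.BoundedWeights) (hD : S.WeakDependence) :
    ∃ K > 0, ∀ᶠ N : ℕ in atTop, ∀ (F : Type) [NormedAddCommGroup F] [InnerProductSpace ℝ F]
      (w : Fin N → F) (a : ℝ), 0 < a →
      (S.design N).law.real {A | a ≤ ‖∑ i, (S.design N).dev i A • w i‖} ≤
        K * (∑ i, ‖w i‖ ^ 2) / a ^ 2 := by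
  obtain ⟨c₁, h₁, c₂, h₂, h0, hlt, hd⟩ := hW.exists_Icc
  obtain ⟨C, hC⟩ := hD
  have hc₂ : 0 < c₂ := h0.trans hlt
  refine ⟨c₂ + |C| * c₂ ^ 2, by positivity, hC.mono fun N hN F _ _ w a ha => ?_⟩
  refine (SamplingDesign.measureReal_norm_ge_le _ ha).trans ?_
  gcongr
  exact SamplingDesign.integral_norm_sum_dev_sq_le (hW.π_pos N) w (fun i => (hd N i).2) hc₂.le
    (fun i j hij => (hN i j hij).trans (le_abs_self C)) (abs_nonneg C)

theorem exists_mul_norm_sq_le_sum_inner_sq (hM : S.MomentConditions) :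
    ∃ κ > 0, ∀ᶠ N : ℕ in atTop, ∀ v : EuclideanSpace ℝ (Fin p ⊕ Unit),
      κ * N * ‖v‖ ^ 2 ≤ ∑ i, inner ℝ v (S.zVec N i) ^ 2 := by
  obtain ⟨M, hM, hlim⟩ := hM.sigma_z
  obtain ⟨κ, hκ, h⟩ := hM.exists_eventually_mul_le hlim
  refine ⟨κ, hκ, ?_⟩
  filter_upwards [h, eventually_gt_atTop 0] with N hN hpos v
  have hN0 : (0 : ℝ) < N := by exact_mod_cast hpos
  have h1 := hN v.ofLp
  rw [smul_mulVec, dotProduct_smul, smul_eq_mul, ← norm_toLp_sq, WithLp.toLp_ofLp,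
    le_inv_mul_iff₀ hN0, sum_mulVec, dotProduct_sum] at h1
  calc κ * N * ‖v‖ ^ 2 = N * (κ * ‖v‖ ^ 2) := by ring
    _ ≤ _ := h1
    _ = _ := by
      refine Finset.sum_congr rfl fun i _ => ?_
      rw [vecMulVec_mulVec, inner_toLp_zVec, op_smul_eq_smul, dotProduct_smul, smul_eq_mul,
        dotProduct_comm (S.z N i), sq]

/-- The normal equations that define `γ_N`, and boundedness of `γ_N`. -/
theorem exists_norm_γVec_le (hS : S.RegularEntropy) (hW : S.BoundedWeights)
    (hM : S.MomentConditions) :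
    ∃ Γ > 0, ∀ᶠ N : ℕ in atTop, ‖S.γVec N‖ ≤ Γ ∧
      ∑ i, (S.π N i * S.residual N i / S.g' (S.d N i)) • S.zVec N i = 0 := by
  obtain ⟨κ, hκ, hlow⟩ := exists_mul_norm_sq_le_sum_inner_sq hM
  obtain ⟨C, hC, hmom⟩ := exists_sum_sqNorm_sq_le hS hW hM
  obtain ⟨m, hm, M, hM0, hg⟩ := exists_inv_g'_bounds hS hW
  obtain ⟨c₁, h₁, c₂, h₂, h0, hlt, hd⟩ := hW.exists_Icc
  have hc₂ : 0 < c₂ := h0.trans hlt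
  refine ⟨M * (C + 1) / (c₂⁻¹ * m * κ), by positivity, ?_⟩
  filter_upwards [hlow, hmom, eventually_gt_atTop 0] with N hlow hmom hpos
  have hN0 : (0 : ℝ) < N := by exact_mod_cast hpos
  have hπ : ∀ i, c₂⁻¹ ≤ S.π N i := fun i =>
    inv_le_of_inv_le₀ (hW.π_pos N i) (hd N i).2
  have hwt : ∀ i, c₂⁻¹ * m ≤ S.π N i / S.g' (S.d N i) := fun i => by
    rw [div_eq_mul_inv]
    exact mul_le_mul (hπ i) (hg N i).1 hm.le (hW.π_pos N i).le
  set H : Matrix (Fin p ⊕ Unit) (Fin p ⊕ Unit) ℝ :=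
    ∑ i, (S.π N i / S.g' (S.d N i)) • vecMulVec (S.z N i) (S.z N i) with hH
  -- The weights `π_i / g'(d_i)` are at least `c₂⁻¹ m`, so `H` inherits the lower bound on the
  -- population second moment matrix.
  have hquad : ∀ v : EuclideanSpace ℝ (Fin p ⊕ Unit),
      c₂⁻¹ * m * κ * N * ‖v‖ ^ 2 ≤ v.ofLp ⬝ᵥ H *ᵥ v.ofLp := by
    intro v
    rw [hH, sum_mulVec, dotProduct_sum]
    calc c₂⁻¹ * m * κ * N * ‖v‖ ^ 2 = c₂⁻¹ * m * (κ * N * ‖v‖ ^ 2) := by ring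
      _ ≤ c₂⁻¹ * m * ∑ i, inner ℝ v (S.zVec N i) ^ 2 := by
          gcongr; exact hlow v
      _ = ∑ i, c₂⁻¹ * m * inner ℝ v (S.zVec N i) ^ 2 := Finset.mul_sum _ _ _
      _ ≤ _ := by
          refine Finset.sum_le_sum fun i _ => ?_
          rw [smul_mulVec, dotProduct_smul, vecMulVec_mulVec, inner_toLp_zVec, op_smul_eq_smul,
            dotProduct_smul, smul_eq_mul, smul_eq_mul, dotProduct_comm (S.z N i), ← sq]
          exact mul_le_mul_of_nonneg_right (hwt i) (sq_nonneg _)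
  have hker : ∀ v, H *ᵥ v = 0 → v = 0 := by
    intro v hv
    have h1 := hquad (WithLp.toLp 2 v)
    rw [hv, dotProduct_zero] at h1
    have h2 : ‖(WithLp.toLp 2 v : EuclideanSpace ℝ (Fin p ⊕ Unit))‖ ^ 2 ≤ 0 := by
      by_contra hlt
      have : 0 < c₂⁻¹ * m * κ * N * ‖(WithLp.toLp 2 v : EuclideanSpace ℝ (Fin p ⊕ Unit))‖ ^ 2 :=
        mul_pos (by positivity) (not_le.1 hlt)
      linarith
    have h3 := norm_eq_zero.1 (pow_eq_zero_iff two_ne_zero |>.1 (le_antisymm h2 (sq_nonneg _)))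
    exact congrArg (WithLp.ofLp (p := 2)) h3
  have hdet : IsUnit H.det := by
    rw [isUnit_iff_ne_zero]
    intro hdet
    obtain ⟨v, hv, hv'⟩ := exists_mulVec_eq_zero_iff.2 hdet
    exact hv (hker v hv')
  have hnormal : H *ᵥ S.γ N = ∑ i, (S.π N i * S.y N i / S.g' (S.d N i)) • S.z N i := by
    rw [γ, mulVec_mulVec, mul_nonsing_inv _ hdet, one_mulVec]
  constructor
  · have h1 := hquad (S.γVec N)
    have h2 : (S.γVec N).ofLp = S.γ N := rfl
    rw [h2, hnormal, dotProduct_sum] at h1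
    have h3 : ∑ i, S.γ N ⬝ᵥ (S.π N i * S.y N i / S.g' (S.d N i)) • S.z N i ≤
        ‖S.γVec N‖ * (M * ((C + 1) * N)) := by
      calc _ ≤ ∑ i, ‖S.γVec N‖ * (M * S.sqNorm N i) := by
            refine Finset.sum_le_sum fun i _ => ?_
            rw [← h2, dotProduct_smul, ← inner_toLp_zVec, smul_eq_mul]
            refine (le_abs_self _).trans ?_
            rw [abs_mul, div_eq_mul_inv, abs_mul, abs_mul, abs_of_pos (hW.π_pos N i),
              abs_of_pos (hm.trans_le (hg N i).1)]
            have h4 : S.π N i ≤ 1 := (S.design N).incl_le_one i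
            have h5 := hW.π_pos N i
            have h6 := (hg N i).2
            have h6' := hm.trans_le (hg N i).1
            have h7 := abs_real_inner_le_norm (S.γVec N) (S.zVec N i)
            have h8 : |S.y N i| * ‖S.zVec N i‖ ≤ S.sqNorm N i := by
              rw [sqNorm, ← sq_abs (S.y N i)]
              nlinarith [sq_nonneg (|S.y N i| - ‖S.zVec N i‖), sq_nonneg |S.y N i|,
                sq_nonneg ‖S.zVec N i‖]
            calc _ ≤ 1 * |S.y N i| * M * (‖S.γVec N‖ * ‖S.zVec N i‖) := by gcongr
              _ = ‖S.γVec N‖ * (M * (|S.y N i| * ‖S.zVec N i‖)) := by ring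
              _ ≤ _ := by gcongr
        _ = ‖S.γVec N‖ * (M * ∑ i, S.sqNorm N i) := by rw [Finset.mul_sum, Finset.mul_sum]
        _ ≤ _ := by
            gcongr
            exact sum_sqNorm_le hmom
    rcases (norm_nonneg (S.γVec N)).eq_or_lt with h | h
    · rw [← h]; positivity
    · rw [le_div_iff₀ (by positivity)]
      have h4 := h1.trans h3
      refine le_of_mul_le_mul_right ?_ (mul_pos hN0 h)
      nlinarith
  · have h1 : ∑ i, (S.π N i * S.residual N i / S.g' (S.d N i)) • S.z N i =
        ∑ i, (S.π N i * S.y N i / S.g' (S.d N i)) • S.z N i - H *ᵥ S.γ N := by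
      rw [hH, sum_mulVec, ← Finset.sum_sub_distrib]
      refine Finset.sum_congr rfl fun i _ => ?_
      rw [smul_mulVec, vecMulVec_mulVec, op_smul_eq_smul, smul_smul, ← sub_smul, residual]
      congr 1
      ring
    rw [hnormal, sub_self] at h1
    have := congrArg (WithLp.toLp 2) h1
    simpa only [zVec, WithLp.toLp_sum, WithLp.toLp_smul, WithLp.toLp_zero] using this

/-- The second moment matrix of the sample is uniformly positive definite with probability
tending to one. -/
theorem exists_tendsto_measureReal_not_mul_le_sum_inner_sq (hS : S.RegularEntropy)
    (hW : S.BoundedWeights) (hD : S.WeakDependence) (hM : S.MomentConditions) :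
    ∃ κ > 0, Tendsto (fun N : ℕ => (S.design N).law.real
      {A | ¬ ∀ v : EuclideanSpace ℝ (Fin p ⊕ Unit),
        κ * N * ‖v‖ ^ 2 ≤ ∑ i ∈ A, inner ℝ v (S.zVec N i) ^ 2}) atTop (𝓝 0) := by
  obtain ⟨κ, hκ, hlow⟩ := exists_mul_norm_sq_le_sum_inner_sq hM
  obtain ⟨C, hC, hmom⟩ := exists_sum_sqNorm_sq_le hS hW hM
  obtain ⟨K, hK, hcheb⟩ := exists_measureReal_norm_sum_dev_ge_le hW hD
  obtain ⟨c₁, h₁, c₂, h₂, h0, hlt, hd⟩ := hW.exists_Icc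
  have hc₂ : 0 < c₂ := h0.trans hlt
  -- The factor `c₂⁻¹` bounds `π_i` from below; the remaining half is reserved for the random
  -- fluctuation.
  set κ' := c₂⁻¹ * κ / 2 with hκ'
  have hκ'0 : 0 < κ' := by positivity
  refine ⟨κ', hκ'0, ?_⟩
  have hlim : Tendsto (fun N : ℕ => K * C / κ' ^ 2 * (N : ℝ)⁻¹) atTop (𝓝 0) := by
    simpa using (tendsto_inv_atTop_nhds_zero_nat (𝕜 := ℝ)).const_mul (K * C / κ' ^ 2)
  refine squeeze_zero' (Eventually.of_forall fun N => measureReal_nonneg) ?_ hlim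
  filter_upwards [hlow, hmom, hcheb, eventually_gt_atTop 0] with N hlow hmom hcheb hpos
  have hN0 : (0 : ℝ) < N := by exact_mod_cast hpos
  -- The tensor square `v ⊗ v`, for which `⟨u, v⟩²` is an inner product. One application of
  -- Chebyshev's inequality to the sum of tensors then handles all directions `v` at once.
  let sq2 : EuclideanSpace ℝ (Fin p ⊕ Unit) →
      EuclideanSpace ℝ ((Fin p ⊕ Unit) × (Fin p ⊕ Unit)) :=
    fun v => WithLp.toLp 2 fun jk => v jk.1 * v jk.2
  have hinner : ∀ u v, inner ℝ (sq2 u) (sq2 v) = inner ℝ u v ^ 2 := by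
    intro u v
    simp only [sq2, PiLp.inner_apply, RCLike.inner_apply, conj_trivial, sq, Finset.sum_mul_sum,
      Fintype.sum_prod_type]
    refine Finset.sum_congr rfl fun i _ => Finset.sum_congr rfl fun j _ => ?_
    ring
  have hnorm : ∀ v, ‖sq2 v‖ = ‖v‖ ^ 2 := by
    intro v
    refine (sq_eq_sq₀ (norm_nonneg _) (by positivity)).1 ?_
    rw [← real_inner_self_eq_norm_sq, hinner, real_inner_self_eq_norm_sq]
  set w := fun i => S.π N i • sq2 (S.zVec N i) with hw
  have hbad : {A | ¬ ∀ v : EuclideanSpace ℝ (Fin p ⊕ Unit),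
        κ' * N * ‖v‖ ^ 2 ≤ ∑ i ∈ A, inner ℝ v (S.zVec N i) ^ 2} ⊆
      {A | κ' * N ≤ ‖∑ i, (S.design N).dev i A • w i‖} := by
    intro A hA
    by_contra hlt
    refine hA fun v => ?_
    simp only [Set.mem_ofPred_eq, not_le] at hlt
    have h1 : ∑ i ∈ A, inner ℝ v (S.zVec N i) ^ 2 =
        inner ℝ (sq2 v) (∑ i, w i - ∑ i, (S.design N).dev i A • w i) := by
      rw [← SamplingDesign.sum_smul_eq_sub_sum_dev, inner_sum]
      refine Finset.sum_congr rfl fun i _ => ?_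
      have : (S.design N).incl i ≠ 0 := (hW.π_pos N i).ne'
      rw [hw, smul_smul, π, inv_mul_cancel₀ this, one_smul, hinner]
    have h2 : c₂⁻¹ * (κ * N * ‖v‖ ^ 2) ≤ inner ℝ (sq2 v) (∑ i, w i) := by
      calc _ ≤ c₂⁻¹ * ∑ i, inner ℝ v (S.zVec N i) ^ 2 := by
            gcongr; exact hlow v
        _ ≤ _ := by
            rw [inner_sum, Finset.mul_sum]
            refine Finset.sum_le_sum fun i _ => ?_
            rw [hw, real_inner_smul_right, hinner]
            exact mul_le_mul_of_nonneg_right (inv_le_of_inv_le₀ (hW.π_pos N i) (hd N i).2)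
              (sq_nonneg _)
    have h3 : inner ℝ (sq2 v) (∑ i, (S.design N).dev i A • w i) ≤ ‖v‖ ^ 2 * (κ' * N) := by
      refine (real_inner_le_norm _ _).trans ?_
      rw [hnorm]
      gcongr
    rw [h1, inner_sub_right]
    have h4 : κ' * N * ‖v‖ ^ 2 = c₂⁻¹ * (κ * N * ‖v‖ ^ 2) / 2 := by rw [hκ']; ring
    have h5 : ‖v‖ ^ 2 * (κ' * N) = c₂⁻¹ * (κ * N * ‖v‖ ^ 2) / 2 := by rw [hκ']; ring
    linarith
  refine (measureReal_mono hbad).trans ((hcheb _ w (κ' * N) (by positivity)).trans ?_)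
  have hsum : ∑ i, ‖w i‖ ^ 2 ≤ C * N := by
    refine le_trans (Finset.sum_le_sum fun i _ => ?_) hmom
    refine pow_le_pow_left₀ (norm_nonneg _) ?_ 2
    rw [hw, norm_smul, hnorm, Real.norm_of_nonneg (hW.π_pos N i).le]
    calc _ ≤ 1 * ‖S.zVec N i‖ ^ 2 := by
          gcongr; exact (S.design N).incl_le_one i
      _ ≤ _ := by rw [one_mul]; exact norm_zVec_sq_le N i
  calc K * (∑ i, ‖w i‖ ^ 2) / (κ' * N) ^ 2 ≤ K * (C * N) / (κ' * N) ^ 2 := by gcongr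
    _ = _ := by field_simp

/-- Since `g(V)` is an interval, the admissible multipliers form a convex set. This upgrades the
condition at each fixed `λ` near `λ₀` to a whole ball from some `N` on. -/
theorem exists_closedBall_subset (hS : S.RegularEntropy) (hW : S.BoundedWeights)
    (hM : S.MomentConditions) :
    ∃ r > 0, ∀ᶠ N : ℕ in atTop,
      ∀ l ∈ Metric.closedBall (WithLp.toLp 2 lam₀ : EuclideanSpace ℝ (Fin p ⊕ Unit)) r,
        ∀ i, l.ofLp ⬝ᵥ S.z N i ∈ S.g '' S.V := by
  have hconv : ∀ N, Convex ℝ {l : EuclideanSpace ℝ (Fin p ⊕ Unit) |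
      ∀ i : Fin N, l.ofLp ⬝ᵥ S.z N i ∈ S.g '' S.V} := by
    intro N u hu v hv a b ha hb hab i
    have := (hS.ordConnected_image_g hW.nontrivial).convex (hu i) (hv i) ha hb hab
    simpa only [WithLp.ofLp_add, WithLp.ofLp_smul, add_dotProduct, smul_dotProduct] using this
  refine exists_ball_eventually_subset hconv ?_
  have hcont : Tendsto (fun l : EuclideanSpace ℝ (Fin p ⊕ Unit) => l.ofLp)
      (𝓝 (WithLp.toLp 2 lam₀)) (𝓝 lam₀) :=
    (PiLp.continuous_ofLp 2 _).tendsto _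
  exact hcont.eventually (hM.gamma_exists.mono fun l hl => hl.1)

end EntropyCalibration

/-! ### The calibration and regression estimators differ by `o_p(√N)`. -/

namespace EntropyCalibration

variable {p : ℕ} {S : EntropyCalibration p}

theorem residual_sq_le {N : ℕ} {Γ : ℝ} (h : ‖S.γVec N‖ ≤ Γ) (i : Fin N) :
    S.residual N i ^ 2 ≤ (1 + Γ ^ 2) * S.sqNorm N i := by
  have h1 : |inner ℝ (S.γVec N) (S.zVec N i)| ≤ Γ * ‖S.zVec N i‖ :=
    (abs_real_inner_le_norm _ _).trans (by gcongr)
  have h2 : inner ℝ (S.γVec N) (S.zVec N i) ^ 2 ≤ (Γ * ‖S.zVec N i‖) ^ 2 := by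
    rw [← sq_abs]
    exact pow_le_pow_left₀ (abs_nonneg _) h1 2
  have h3 : -(2 * (S.y N i * inner ℝ (S.γVec N) (S.zVec N i))) ≤
      2 * (|S.y N i| * (Γ * ‖S.zVec N i‖)) := by
    have : |S.y N i * inner ℝ (S.γVec N) (S.zVec N i)| ≤ |S.y N i| * (Γ * ‖S.zVec N i‖) := by
      rw [abs_mul]; gcongr
    linarith [neg_abs_le (S.y N i * inner ℝ (S.γVec N) (S.zVec N i))]
  rw [residual_eq, sqNorm]
  have h4 := sq_abs (S.y N i)
  nlinarith [sq_nonneg (Γ * |S.y N i| - ‖S.zVec N i‖)]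

theorem norm_zVec_mul_abs_residual_le {N : ℕ} {Γ : ℝ} (h : ‖S.γVec N‖ ≤ Γ) (i : Fin N) :
    ‖S.zVec N i‖ * |S.residual N i| ≤ (1 + Γ ^ 2) * S.sqNorm N i := by
  have h1 := residual_sq_le h i
  have h2 := norm_zVec_sq_le (S := S) N i
  have h3 := sq_abs (S.residual N i)
  have h4 := mul_nonneg (sq_nonneg Γ) (sqNorm_nonneg (S := S) N i)
  nlinarith [sq_nonneg (‖S.zVec N i‖ - |S.residual N i|)]

/-- With probability tending to one, calibration weights exist and the calibration estimator
differs from the regression estimator by less than `τ √N`. -/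
theorem tendsto_measureReal_not_exists_abs_sub_greg_lt (hS : S.RegularEntropy)
    (hW : S.BoundedWeights) (hD : S.WeakDependence) (hM : S.MomentConditions) {τ : ℝ}
    (hτ : 0 < τ) :
    Tendsto (fun N : ℕ => (S.design N).law.real {A | ¬ ∃ ω : A → ℝ, S.IsCalibrated N A ω ∧
      |S.estimator N A ω - S.greg N A| < τ * √N}) atTop (𝓝 0) := by
  obtain ⟨C, hC, hmom⟩ := exists_sum_sqNorm_sq_le hS hW hM
  obtain ⟨K, hK, hcheb⟩ := exists_measureReal_norm_sum_dev_ge_le hW hD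
  obtain ⟨Γ, hΓ, hγ⟩ := exists_norm_γVec_le hS hW hM
  obtain ⟨m₀, hm₀, B, hB, hg⟩ := exists_inv_g'_bounds hS hW
  obtain ⟨κ, hκ, hlow⟩ := exists_tendsto_measureReal_not_mul_le_sum_inner_sq hS hW hD hM
  obtain ⟨r₀, hr₀, hball⟩ := exists_closedBall_subset hS hW hM
  obtain ⟨c₁, h₁, c₂, h₂, hc₁, hlt, hd⟩ := hW.exists_Icc
  set m := m₀ / 2 with hm
  have hm0 : 0 < m := half_pos hm₀
  set Λ := 1 + Γ ^ 2 with hΛ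
  have hΛ0 : 0 < Λ := by positivity
  set L := 1 + Λ * (C + 1) with hL
  have hL0 : 0 < L := by positivity
  refine tendsto_order.2 ⟨fun a ha => Eventually.of_forall fun N => ha.trans_le measureReal_nonneg,
    fun δ hδ => ?_⟩
  -- The bound for the event `b √N ≤ R` is the constant `K (C + 1) / b²`, which does not decay with
  -- `N`; it is made small through `ε`, as `b` is proportional to `1 / ε`. The condition `ε ≤ m`
  -- ensures `m + ε ≤ m₀`.
  obtain ⟨ε, hε, hεm, hεδ⟩ : ∃ ε > 0, ε ≤ m ∧
      K * (C + 1) * (ε * L / (τ * m * κ)) ^ 2 < δ / 2 := by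
    have hc : Tendsto (fun ε : ℝ => K * (C + 1) * (ε * L / (τ * m * κ)) ^ 2) (𝓝[>] 0)
        (𝓝 0) := by
      have : Continuous fun ε : ℝ => K * (C + 1) * (ε * L / (τ * m * κ)) ^ 2 := by fun_prop
      simpa using (this.tendsto 0).mono_left nhdsWithin_le_nhds
    have h1 := hc.eventually_lt_const (half_pos hδ)
    have h2 : ∀ᶠ ε : ℝ in 𝓝[>] 0, ε ∈ Set.Ioc 0 m := Ioc_mem_nhdsGT hm0
    obtain ⟨ε, h3, h4⟩ := (h1.and h2).exists
    exact ⟨ε, h4.1, h4.2, h3⟩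
  obtain ⟨η, hη, hexp⟩ := hS.exists_gInv_add_sub_le hW.nontrivial isCompact_Icc
    (hS.interval.out h₁ h₂) hε
  -- Integer powers of `s = N^(1/8)` express all rates. The radius is `s^(-3)`: since `‖z_i‖⁴ ≤ C
  -- N`, the increments satisfy `(r ‖z_i‖)⁴ ≤ C s^(-4)`, while `N r = s^5` dominates `√N = s^4`.
  set s : ℕ → ℝ := fun N => (N : ℝ) ^ (1 / 8 : ℝ) with hs
  have hs8 : ∀ N, s N ^ 8 = N := fun N => by
    rw [hs, ← Real.rpow_natCast, ← Real.rpow_mul (Nat.cast_nonneg N)]; norm_num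
  have hslim : Tendsto s atTop atTop :=
    (tendsto_rpow_atTop (by norm_num)).comp tendsto_natCast_atTop_atTop
  set r : ℕ → ℝ := fun N => (s N ^ 3)⁻¹ with hr
  have hrlim : ∀ᶠ N in atTop, r N ≤ r₀ :=
    (((tendsto_pow_atTop three_ne_zero).comp hslim).inv_tendsto_atTop).eventually_le_const hr₀
  have hpow : ∀ (k : ℕ) (c : ℝ), k ≠ 0 → Tendsto (fun N => c * (s N ^ k)⁻¹) atTop (𝓝 0) := by
    intro k c hk
    simpa using (((tendsto_pow_atTop hk).comp hslim).inv_tendsto_atTop).const_mul c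
  have hrη : ∀ᶠ N in atTop, C * (s N ^ 4)⁻¹ ≤ η ^ 4 :=
    (hpow 4 C (by norm_num)).eventually_le_const (by positivity)
  have hbad2 : ∀ᶠ N in atTop, K * (C + 1) / (m * κ) ^ 2 * (s N ^ 2)⁻¹ < δ / 6 :=
    (hpow 2 _ (by norm_num)).eventually_lt_const (by positivity)
  have hbad3 : ∀ᶠ N in atTop, K * (B ^ 2 * Λ * C) / ε ^ 2 * (s N ^ 8)⁻¹ < δ / 6 :=
    (hpow 8 _ (by norm_num)).eventually_lt_const (by positivity)
  have hbad1 := hlow.eventually_lt_const (show (0 : ℝ) < δ / 6 by positivity)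
  filter_upwards [hmom, hcheb, hγ, hball, hrlim, hrη, hbad1, hbad2, hbad3, eventually_gt_atTop 0,
    hslim.eventually_gt_atTop 0] with N hmom hcheb hγ hball hrlim hrη hbad1 hbad2 hbad3 hpos hsN
  have hN0 : (0 : ℝ) < N := by exact_mod_cast hpos
  have hrN : 0 < r N := by positivity
  set w := fun i => (S.π N i * S.residual N i / S.g' (S.d N i)) • S.zVec N i with hw
  set R := fun A : Finset (Fin N) => ‖∑ i, (S.design N).dev i A • S.zVec N i‖ with hR
  set b := τ * m * κ / (ε * L) with hb
  have hb0 : 0 < b := by positivity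
  have hz2 : ∑ i, ‖S.zVec N i‖ ^ 2 ≤ (C + 1) * N :=
    (Finset.sum_le_sum fun i _ => norm_zVec_sq_le N i).trans (sum_sqNorm_le hmom)
  have hw2 : ∑ i, ‖w i‖ ^ 2 ≤ B ^ 2 * Λ * C * N := by
    calc ∑ i, ‖w i‖ ^ 2 ≤ ∑ i, B ^ 2 * Λ * S.sqNorm N i ^ 2 := by
          refine Finset.sum_le_sum fun i _ => ?_
          rw [hw, norm_smul, mul_pow, Real.norm_eq_abs, sq_abs, div_eq_mul_inv, mul_pow, mul_pow]
          have e1 : S.π N i ^ 2 ≤ 1 :=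
            pow_le_one₀ (hW.π_pos N i).le ((S.design N).incl_le_one i)
          have e2 : (S.g' (S.d N i))⁻¹ ^ 2 ≤ B ^ 2 :=
            pow_le_pow_left₀ (hm₀.trans_le (hg N i).1).le (hg N i).2 2
          have e3 := residual_sq_le hγ.1 i
          have e4 := norm_zVec_sq_le (S := S) N i
          have e5 := sqNorm_nonneg (S := S) N i
          calc _ ≤ 1 * (Λ * S.sqNorm N i) * B ^ 2 * S.sqNorm N i := by gcongr
            _ = _ := by ring
      _ = B ^ 2 * Λ * ∑ i, S.sqNorm N i ^ 2 := by rw [Finset.mul_sum]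
      _ ≤ B ^ 2 * Λ * (C * N) := by gcongr
      _ = _ := by ring
  -- The bad events are: a degenerate sample second moment matrix, a defect too large for the ball,
  -- a linear coefficient not negligible against `N`, and a defect too large against `√N`.
  have hsub : {A : Finset (Fin N) | ¬ ∃ ω : A → ℝ, S.IsCalibrated N A ω ∧
      |S.estimator N A ω - S.greg N A| < τ * √N} ⊆
      ({A | ¬ ∀ v : EuclideanSpace ℝ (Fin p ⊕ Unit),
        κ * N * ‖v‖ ^ 2 ≤ ∑ i ∈ A, inner ℝ v (S.zVec N i) ^ 2} ∪
      {A | m * (κ * N) * r N ≤ R A}) ∪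
      ({A | ε * N ≤ ‖∑ i, (S.design N).dev i A • w i‖} ∪ {A | b * √N ≤ R A}) := by
    intro A hA
    by_contra hcon
    simp only [Set.mem_union, Set.mem_ofPred_eq, not_or, not_not, not_le] at hcon
    obtain ⟨⟨hA1, hA2⟩, hA3, hA4⟩ := hcon
    refine hA ?_
    obtain ⟨ω, hω, hdiff⟩ := exists_isCalibrated_and_abs_sub_greg_le hS hW (η := η) hrN hm0
      (mul_pos hκ hN0) hε.le
      (fun l hl => hball l (Metric.closedBall_subset_closedBall hrlim hl))
      (fun i => hexp _ (hd N i))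
      (fun i => by
        refine (pow_le_pow_iff_left₀ (by positivity) hη.le four_ne_zero).1 (le_trans ?_ hrη)
        have e1 : S.sqNorm N i ^ 2 ≤ C * N := (Finset.single_le_sum
          (f := fun i => S.sqNorm N i ^ 2) (fun j _ => sq_nonneg _) (Finset.mem_univ i)).trans hmom
        have e2 : (‖S.zVec N i‖ ^ 2) ^ 2 ≤ S.sqNorm N i ^ 2 :=
          pow_le_pow_left₀ (sq_nonneg _) (norm_zVec_sq_le N i) 2
        calc (r N * ‖S.zVec N i‖) ^ 4 = r N ^ 4 * (‖S.zVec N i‖ ^ 2) ^ 2 := by ring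
          _ ≤ r N ^ 4 * (C * N) := by gcongr; exact e2.trans e1
          _ = C * (s N ^ 4)⁻¹ := by
            rw [← hs8 N, hr]
            field_simp)
      (fun i => by have := (hg N i).1; rw [hm] at hεm ⊢; linarith)
      hA1 hA2
    refine ⟨ω, hω, ?_⟩
    -- The normal equations make the total of `w` zero, so the sample sum is a pure Horvitz–Thompson
    -- error.
    have hres : ∑ i ∈ A, (S.residual N i / S.g' (S.d N i)) • S.zVec N i =
        -∑ i, (S.design N).dev i A • w i := by
      have e1 := SamplingDesign.sum_smul_eq_sub_sum_dev (D := S.design N) w A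
      rw [show ∑ i, w i = 0 from hγ.2, zero_sub] at e1
      rw [← e1]
      refine Finset.sum_congr rfl fun i _ => ?_
      have : (S.design N).incl i ≠ 0 := (hW.π_pos N i).ne'
      rw [smul_smul, π]
      congr 1
      field_simp
    rw [hres, norm_neg] at hdiff
    have hze : ∑ i, ‖S.zVec N i‖ * |S.residual N i| ≤ Λ * ((C + 1) * N) := by
      calc _ ≤ ∑ i, Λ * S.sqNorm N i :=
            Finset.sum_le_sum fun i _ => norm_zVec_mul_abs_residual_le hγ.1 i
        _ = Λ * ∑ i, S.sqNorm N i := by rw [Finset.mul_sum]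
        _ ≤ _ := by gcongr; exact sum_sqNorm_le hmom
    have hRA : 0 ≤ R A := norm_nonneg _
    have h1 : m * (κ * N) * |S.estimator N A ω - S.greg N A| ≤ R A * (ε * L * N) := by
      refine hdiff.trans (mul_le_mul_of_nonneg_left ?_ hRA)
      calc _ ≤ ε * N + ε * (Λ * ((C + 1) * N)) := by gcongr
        _ = _ := by rw [hL]; ring
    have h2 : R A * (ε * L * N) < b * √N * (ε * L * N) :=
      mul_lt_mul_of_pos_right hA4 (by positivity)
    have h3 : b * √N * (ε * L * N) = m * (κ * N) * (τ * √N) := by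
      rw [hb]; field_simp
    exact lt_of_mul_lt_mul_left ((h1.trans_lt h2).trans_eq h3) (by positivity)
  have hP2 : (S.design N).law.real {A | m * (κ * N) * r N ≤ R A} < δ / 6 := by
    refine (hcheb _ (S.zVec N) _ (by positivity)).trans_lt (lt_of_le_of_lt ?_ hbad2)
    calc _ ≤ K * ((C + 1) * N) / (m * (κ * N) * r N) ^ 2 := by gcongr
      _ = _ := by
        rw [← hs8 N, hr]
        field_simp
  have hP3 : (S.design N).law.real {A | ε * N ≤ ‖∑ i, (S.design N).dev i A • w i‖} < δ / 6 := by
    refine (hcheb _ w _ (by positivity)).trans_lt (lt_of_le_of_lt ?_ hbad3)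
    calc _ ≤ K * (B ^ 2 * Λ * C * N) / (ε * N) ^ 2 := by gcongr
      _ = _ := by
        rw [hs8 N]
        field_simp
  have hP4 : (S.design N).law.real {A | b * √N ≤ R A} < δ / 2 := by
    refine (hcheb _ (S.zVec N) _ (by positivity)).trans_lt (lt_of_le_of_lt ?_ hεδ)
    calc _ ≤ K * ((C + 1) * N) / (b * √N) ^ 2 := by gcongr
      _ = _ := by
        rw [mul_pow, Real.sq_sqrt hN0.le, hb]
        field_simp
  have hun := (measureReal_mono (μ := (S.design N).law) hsub).trans (measureReal_union_le _ _)
  have hun1 := measureReal_union_le (μ := (S.design N).law)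
    {A | ¬ ∀ v : EuclideanSpace ℝ (Fin p ⊕ Unit),
        κ * N * ‖v‖ ^ 2 ≤ ∑ i ∈ A, inner ℝ v (S.zVec N i) ^ 2} {A | m * (κ * N) * r N ≤ R A}
  have hun2 := measureReal_union_le (μ := (S.design N).law)
    {A | ε * N ≤ ‖∑ i, (S.design N).dev i A • w i‖} {A | b * √N ≤ R A}
  linarith

end EntropyCalibration

/-! ### The limit law and the asymptotic variance. -/

namespace EntropyCalibration

variable {p : ℕ} {S : EntropyCalibration p}

theorem greg_eq (N : ℕ) (A : Finset (Fin N)) :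
    S.greg N A = S.θ N + ∑ i, (S.design N).dev i A * -S.residual N i := by
  have h := SamplingDesign.sum_smul_eq_sub_sum_dev (D := S.design N) (S.residual N) A
  simp only [smul_eq_mul] at h
  simp only [greg, π, h, θ, mul_neg, Finset.sum_neg_distrib, ← sub_eq_add_neg, ← add_sub_assoc]
  congr 1
  rw [← Finset.sum_add_distrib]
  refine Finset.sum_congr rfl fun i _ => ?_
  rw [residual]
  ring

theorem variance_greg (hW : S.BoundedWeights) (N : ℕ) :
    variance (S.greg N) (S.design N).law = S.gregVar N := by
  have h : S.greg N = fun A => S.θ N + ∑ i, (S.design N).dev i A * -S.residual N i :=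
    funext (greg_eq N)
  rw [h, SamplingDesign.variance_sum_dev (hW.π_pos N), gregVar]
  refine Finset.sum_congr rfl fun i _ => Finset.sum_congr rfl fun j _ => ?_
  rw [π, π]
  ring

/-- The coefficients `(-1, γ_N)` of the error of the regression estimator in terms of the
Horvitz–Thompson errors of `(y_i, z_i)`. -/
def gregCoef (S : EntropyCalibration p) (N : ℕ) : Unit ⊕ (Fin p ⊕ Unit) → ℝ :=
  Sum.elim (fun _ => -1) (S.γ N)

theorem gregCoef_dotProduct_yz (N : ℕ) (i : Fin N) :
    S.gregCoef N ⬝ᵥ S.yz N i = -S.residual N i := by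
  have h : S.gregCoef N ⬝ᵥ S.yz N i = -S.y N i + S.γ N ⬝ᵥ S.z N i := by
    simp only [gregCoef, yz, dotProduct]
    rw [Fintype.sum_sum_type]
    simp
  rw [h, residual, dotProduct_comm]
  ring

theorem one_le_gregCoef_dotProduct (N : ℕ) : 1 ≤ S.gregCoef N ⬝ᵥ S.gregCoef N := by
  simp only [gregCoef, dotProduct]
  rw [Fintype.sum_sum_type]
  simp only [Sum.elim_inl, Sum.elim_inr, Finset.univ_unique, Finset.sum_singleton]
  have : 0 ≤ ∑ j, S.γ N j * S.γ N j := Finset.sum_nonneg fun j _ => mul_self_nonneg _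
  linarith

theorem greg_sub_θ (N : ℕ) (A : Finset (Fin N)) :
    S.greg N A - S.θ N = S.gregCoef N ⬝ᵥ (S.design N).htError (S.yz N) A := by
  rw [greg_eq, add_sub_cancel_left, SamplingDesign.htError_dotProduct]
  simp_rw [gregCoef_dotProduct_yz]

theorem gregVar_eq (N : ℕ) :
    S.gregVar N = S.gregCoef N ⬝ᵥ (S.design N).htCov (S.yz N) *ᵥ S.gregCoef N := by
  rw [SamplingDesign.dotProduct_htCov_mulVec, gregVar]
  refine Finset.sum_congr rfl fun i _ => Finset.sum_congr rfl fun j _ => ?_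
  rw [gregCoef_dotProduct_yz, gregCoef_dotProduct_yz, π, π, div_eq_mul_inv, div_eq_mul_inv,
    div_eq_mul_inv, mul_inv]
  ring

theorem tendstoInDistribution_greg (hS : S.RegularEntropy) (hW : S.BoundedWeights)
    (hM : S.MomentConditions) (hB1 : S.HTCovariancePosDef) (hB2 : S.HTNormality) :
    TendstoInDistribution
      (fun N (A : Finset (Fin N)) => (S.greg N A - S.θ N) / √(S.gregVar N))
      atTop (id : ℝ → ℝ) (fun N => (S.design N).law) (gaussianReal 0 1) := by
  obtain ⟨M, hMpos, hlim⟩ := hB1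
  simp_rw [greg_sub_θ, gregVar_eq]
  refine SamplingDesign.tendstoInDistribution_dotProduct_htError hW.π_pos hB2
    (boundedFourthMoment_yz hS hW hM) hMpos hlim fun N h => ?_
  have := one_le_gregCoef_dotProduct (S := S) N
  rw [h, dotProduct_zero] at this
  linarith

/-- The variance of the regression estimator is at least of order `N`. -/
theorem exists_mul_le_gregVar (hB1 : S.HTCovariancePosDef) :
    ∃ κ > 0, ∀ᶠ N : ℕ in atTop, κ * N ≤ S.gregVar N := by
  obtain ⟨M, hM, hlim⟩ := hB1
  obtain ⟨κ, hκ, h⟩ := hM.exists_eventually_mul_le hlim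
  refine ⟨κ, hκ, ?_⟩
  filter_upwards [h, eventually_gt_atTop 0] with N hN hpos
  have hN0 : (0 : ℝ) < N := by exact_mod_cast hpos
  have h1 := hN (S.gregCoef N)
  rw [smul_mulVec, dotProduct_smul, smul_eq_mul, ← gregVar_eq] at h1
  have h2 : κ ≤ (S.design N).size / N ^ 2 * S.gregVar N :=
    (le_mul_of_one_le_right hκ.le (one_le_gregCoef_dotProduct N)).trans h1
  have h3 : (S.design N).size ≤ N := by
    rw [SamplingDesign.size_eq]
    refine (Finset.sum_le_sum fun i _ => (S.design N).incl_le_one i).trans ?_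
    simp
  have h0 : 0 ≤ (S.design N).size := (S.design N).size_nonneg
  have hv : 0 ≤ S.gregVar N := by
    by_contra hlt
    have := mul_nonpos_of_nonneg_of_nonpos (div_nonneg h0 (sq_nonneg (N : ℝ))) (not_le.1 hlt).le
    linarith
  have h4 : (S.design N).size / N ^ 2 * S.gregVar N ≤ N / N ^ 2 * S.gregVar N := by gcongr
  have h5 : (N : ℝ) / N ^ 2 * S.gregVar N = S.gregVar N / N := by field_simp
  rw [← le_div_iff₀ hN0]
  linarith

theorem integral_greg_sub_sq (hW : S.BoundedWeights) (N : ℕ) :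
    ∫ A, (S.greg N A - S.θ N) ^ 2 ∂(S.design N).law = S.gregVar N := by
  simp_rw [greg_sub_θ, gregVar_eq]
  exact SamplingDesign.integral_htError_sq (hW.π_pos N) _ _

section Estimator

variable {w : (N : ℕ) → (A : Finset (Fin N)) → A → ℝ}

/-- Uniqueness identifies the prescribed weights with those constructed; samples without a solution
lie in the event of vanishing probability. -/
theorem tendsto_measureReal_abs_sub_greg_ge (hS : S.RegularEntropy)
    (hW : S.BoundedWeights) (hD : S.WeakDependence) (hM : S.MomentConditions)
    (hw : ∀ (N : ℕ) (A : Finset (Fin N)),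
      (∃ ω : A → ℝ, S.IsCalibrated N A ω) → S.IsCalibrated N A (w N A)) {τ : ℝ} (hτ : 0 < τ) :
    Tendsto (fun N : ℕ => (S.design N).law.real
      {A | τ * √N ≤ |S.estimator N A (w N A) - S.greg N A|}) atTop (𝓝 0) := by
  refine squeeze_zero (fun _ => measureReal_nonneg) (fun N => measureReal_mono ?_)
    (tendsto_measureReal_not_exists_abs_sub_greg_lt hS hW hD hM hτ)
  rintro A hA ⟨ω, hω, hlt⟩
  rw [hS.isCalibrated_unique hω (hw N A ⟨ω, hω⟩)] at hlt
  exact absurd hA (not_le.2 hlt)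

/-- Standardization by a sequence asymptotically equivalent to the variance of the regression
estimator. -/
theorem tendstoInDistribution_estimator (hS : S.RegularEntropy) (hW : S.BoundedWeights)
    (hD : S.WeakDependence) (hM : S.MomentConditions) (hB1 : S.HTCovariancePosDef)
    (hB2 : S.HTNormality)
    (hw : ∀ (N : ℕ) (A : Finset (Fin N)),
      (∃ ω : A → ℝ, S.IsCalibrated N A ω) → S.IsCalibrated N A (w N A))
    {v : ℕ → ℝ} (hv : v ~[atTop] S.gregVar) :
    TendstoInDistribution
      (fun N (A : Finset (Fin N)) => (S.estimator N A (w N A) - S.θ N) / √(v N))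
      atTop (id : ℝ → ℝ) (fun N => (S.design N).law) (gaussianReal 0 1) := by
  obtain ⟨κ, hκ, hlow⟩ := exists_mul_le_gregVar hB1
  have hV0 : ∀ᶠ N in atTop, 0 < S.gregVar N := by
    filter_upwards [hlow, eventually_gt_atTop 0] with N hN hpos
    have hN0 : (0 : ℝ) < N := by exact_mod_cast hpos
    exact (mul_pos hκ hN0).trans_le hN
  have hratio : Tendsto (fun N => v N / S.gregVar N) atTop (𝓝 1) :=
    (isEquivalent_iff_tendsto_one (hV0.mono fun N h => h.ne')).1 hv
  have hr : Tendsto (fun N => (√(v N / S.gregVar N))⁻¹) atTop (𝓝 1) := by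
    have := (hratio.sqrt).inv₀ (by simp)
    simpa using this
  refine tendstoInDistribution_gaussianReal_of_sub (tendstoInDistribution_greg hS hW hM hB1 hB2)
    (fun N => Measurable.of_discrete.aemeasurable) fun ε hε => ?_
  -- The Chebyshev bound for the change of scale: the regression error divided by `√gregVar` has
  -- mean square one.
  have h1 : Tendsto (fun N => (1 - (√(v N / S.gregVar N))⁻¹) ^ 2 / (ε / 2) ^ 2) atTop (𝓝 0) := by
    have := ((tendsto_const_nhds (x := (1 : ℝ))).sub hr).pow 2 |>.div_const ((ε / 2) ^ 2)
    simpa using this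
  have h2 := tendsto_measureReal_abs_sub_greg_ge hS hW hD hM hw
    (show 0 < ε / 4 * √κ by positivity)
  refine squeeze_zero' (Eventually.of_forall fun N => measureReal_nonneg) ?_
    (by simpa using h1.add h2)
  filter_upwards [hV0, hlow, hratio.eventually_const_lt zero_lt_one,
    hr.eventually_lt_const one_lt_two] with N hV0 hlow hvpos hr2
  set r := (√(v N / S.gregVar N))⁻¹ with hr
  set σ := √(S.gregVar N) with hσ
  have hσ0 : 0 < σ := Real.sqrt_pos.2 hV0
  have hr0 : 0 ≤ r := by positivity
  have hv' : √(v N) = σ / r := by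
    rw [hr, div_inv_eq_mul, hσ, ← Real.sqrt_mul hV0.le, mul_div_cancel₀ _ hV0.ne']
  have hrpos : 0 < r := inv_pos.2 (Real.sqrt_pos.2 hvpos)
  -- The difference splits into the change of scale and the scaled difference of the estimators. The
  -- constant `ε / 4` allows for `r < 2`, and `√κ √N ≤ σ`.
  refine (measureReal_mono (s₂ := {A | ε / 2 ≤ ‖(1 - r) * ((S.greg N A - S.θ N) / σ)‖} ∪
    {A | ε / 4 * √κ * √N ≤ |S.estimator N A (w N A) - S.greg N A|}) ?_).trans
    ((measureReal_union_le _ _).trans (add_le_add ?_ le_rfl))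
  · intro A hA
    by_contra hcon
    simp only [Set.mem_union, Set.mem_ofPred_eq, not_or, not_le] at hcon hA
    obtain ⟨c1, c2⟩ := hcon
    rw [hv', div_div_eq_mul_div] at hA
    have e1 : (S.greg N A - S.θ N) / σ - (S.estimator N A (w N A) - S.θ N) * r / σ =
        (1 - r) * ((S.greg N A - S.θ N) / σ) -
          r * ((S.estimator N A (w N A) - S.greg N A) / σ) := by ring
    rw [e1] at hA
    have e2 : |r * ((S.estimator N A (w N A) - S.greg N A) / σ)| < ε / 2 := by
      rw [abs_mul, abs_div, abs_of_pos hrpos, abs_of_pos hσ0]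
      have e3 : √κ * √N ≤ σ := by
        rw [← Real.sqrt_mul hκ.le]; exact Real.sqrt_le_sqrt hlow
      have e4 : |S.estimator N A (w N A) - S.greg N A| < ε / 4 * σ := by
        refine c2.trans_le ?_
        rw [mul_assoc]; gcongr
      have e5 : |S.estimator N A (w N A) - S.greg N A| / σ < ε / 4 := by
        rwa [div_lt_iff₀ hσ0]
      have e6 : 0 ≤ |S.estimator N A (w N A) - S.greg N A| / σ := by positivity
      nlinarith
    have e3 := abs_sub ((1 - r) * ((S.greg N A - S.θ N) / σ))
      (r * ((S.estimator N A (w N A) - S.greg N A) / σ))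
    rw [Real.norm_eq_abs] at c1
    linarith
  · refine (SamplingDesign.measureReal_norm_ge_le _ (half_pos hε)).trans_eq ?_
    congr 1
    simp_rw [Real.norm_eq_abs, sq_abs, mul_pow, div_pow]
    rw [integral_const_mul, integral_div, integral_greg_sub_sq hW, hσ, Real.sq_sqrt hV0.le,
      div_self hV0.ne', mul_one]

/-- Standardization by `gregVar` is already known to give a normal limit; two nonnegative scalings
of the same errors with the same limit have ratio tending to one. -/
theorem isEquivalent_gregVar_of_tendstoInDistribution (hS : S.RegularEntropy)
    (hW : S.BoundedWeights) (hD : S.WeakDependence) (hM : S.MomentConditions)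
    (hB1 : S.HTCovariancePosDef) (hB2 : S.HTNormality)
    (hw : ∀ (N : ℕ) (A : Finset (Fin N)),
      (∃ ω : A → ℝ, S.IsCalibrated N A ω) → S.IsCalibrated N A (w N A))
    {v : ℕ → ℝ}
    (hv : TendstoInDistribution
      (fun N (A : Finset (Fin N)) => (S.estimator N A (w N A) - S.θ N) / √(v N))
      atTop (id : ℝ → ℝ) (fun N => (S.design N).law) (gaussianReal 0 1)) :
    v ~[atTop] S.gregVar := by
  obtain ⟨κ, hκ, hlow⟩ := exists_mul_le_gregVar hB1
  have hV0 : ∀ᶠ N in atTop, 0 < S.gregVar N := by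
    filter_upwards [hlow, eventually_gt_atTop 0] with N hN hpos
    have hN0 : (0 : ℝ) < N := by exact_mod_cast hpos
    exact (mul_pos hκ hN0).trans_le hN
  have hr := tendsto_one_of_tendstoInDistribution_mul (r := fun N => √(S.gregVar N) / √(v N))
    (tendstoInDistribution_estimator hS hW hD hM hB1 hB2 hw IsEquivalent.refl) hv
    (fun N => by positivity)
    (hV0.mono fun N hN A => by
      have := (Real.sqrt_pos.2 hN).ne'
      field_simp)
  refine (isEquivalent_iff_tendsto_one (hV0.mono fun N h => h.ne')).2 ?_
  have h1 : Tendsto (fun N => ((√(S.gregVar N) / √(v N)) ^ 2)⁻¹) atTop (𝓝 1) := by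
    simpa using (hr.pow 2).inv₀ (by simp)
  refine h1.congr' ?_
  filter_upwards [hV0, hr.eventually_const_lt zero_lt_one] with N hN hpos
  -- For `v N ≤ 0` the convention `√(v N) = 0` makes the ratio zero, which the limit one excludes
  -- for large `N`.
  have hv0 : 0 < v N := by
    by_contra hle
    rw [Real.sqrt_eq_zero_of_nonpos (not_lt.1 hle), div_zero] at hpos
    exact lt_irrefl _ hpos
  rw [Pi.div_apply, div_pow, Real.sq_sqrt hN.le, Real.sq_sqrt hv0.le, inv_div]

end Estimator

theorem tendsto_measureReal_existsUnique_isCalibrated (hS : S.RegularEntropy)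
    (hW : S.BoundedWeights) (hD : S.WeakDependence) (hM : S.MomentConditions) :
    Tendsto (fun N : ℕ => (S.design N).law.real {A | ∃! ω : A → ℝ, S.IsCalibrated N A ω})
      atTop (𝓝 1) := by
  have h := tendsto_measureReal_not_exists_abs_sub_greg_lt hS hW hD hM one_pos
  have h1 := (tendsto_const_nhds (x := (1 : ℝ))).sub h
  rw [sub_zero] at h1
  refine tendsto_of_tendsto_of_tendsto_of_le_of_le h1 tendsto_const_nhds (fun N => ?_)
    fun N => measureReal_le_one
  have h2 : {A : Finset (Fin N) | ¬ ∃ ω : A → ℝ, S.IsCalibrated N A ω ∧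
      |S.estimator N A ω - S.greg N A| < 1 * √N}ᶜ ⊆
      {A | ∃! ω : A → ℝ, S.IsCalibrated N A ω} := by
    intro A hA
    obtain ⟨ω, hω, -⟩ := not_not.1 hA
    exact ⟨ω, hω, fun ω' hω' => hS.isCalibrated_unique hω' hω⟩
  have h3 := measureReal_mono (μ := (S.design N).law) h2
  rwa [probReal_compl_eq_one_sub .of_discrete] at h3

end EntropyCalibration

end

/-- The calibration problem has a unique solution with probability tending to one; the design
variance of `θ̂_{greg,ℓ}` is given by the double sum; and, whatever value is given to the weights for
samples without a solution, `(θ̂_cal - θ_N) / √v_N` converges in distribution to `N(0, 1)`, that is,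
`v_N` is an asymptotic variance `V(θ̂_cal)`, exactly when `v_N = V(θ̂_{greg,ℓ}) (1 + o(1))`. -/
theorem theorem2 {p : ℕ} (S : EntropyCalibration p)
    (hA1 : S.RegularEntropy) (hA2 : S.BoundedWeights) (hA3 : S.WeakDependence) (hA4 : S.MomentConditions)
    (hB1 : S.HTCovariancePosDef) (hB2 : S.HTNormality) :
    Tendsto (fun N : ℕ => (S.design N).law.real {A | ∃! ω : A → ℝ, S.IsCalibrated N A ω})
      atTop (𝓝 1) ∧
    (∀ N : ℕ, variance (S.greg N) (S.design N).law = S.gregVar N) ∧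
    ∀ w : (N : ℕ) → (A : Finset (Fin N)) → A → ℝ,
      (∀ (N : ℕ) (A : Finset (Fin N)),
        (∃ ω : A → ℝ, S.IsCalibrated N A ω) → S.IsCalibrated N A (w N A)) →
      ∀ v : ℕ → ℝ,
        TendstoInDistribution
          (fun N (A : Finset (Fin N)) => (S.estimator N A (w N A) - S.θ N) / √(v N))
          atTop (id : ℝ → ℝ) (fun N => (S.design N).law) (gaussianReal 0 1) ↔
        v ~[atTop] S.gregVar := by
  refine ⟨EntropyCalibration.tendsto_measureReal_existsUnique_isCalibrated hA1 hA2 hA3 hA4,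
    EntropyCalibration.variance_greg hA2, fun w hw v => ⟨fun hv => ?_, fun hv => ?_⟩⟩
  · exact EntropyCalibration.isEquivalent_gregVar_of_tendstoInDistribution hA1 hA2 hA3 hA4
      hB1 hB2 hw hv
  · exact EntropyCalibration.tendstoInDistribution_estimator hA1 hA2 hA3 hA4 hB1 hB2 hw hv
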